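/- For a permutation $\pi\in S_n$ let $\mathrm{sh}(\pi)$ denote its shape under the Robinson--Schensted correspondence, that is, the common shape of its insertion and recording tableaux, and let $\mathrm{inv}(\pi)$ be its number of inversions. For a partition $\lambda\vdash n$ let $W_\lambda=\{\pi\in S_n:\mathrm{sh}(\pi)=\lambda\}$ and, for an integer $\Delta\ge 0$, let $w_\lambda^\Delta$ be the number of $\pi\in W_\lambda$ with $\mathrm{inv}(\pi)=\min_{\sigma\in W_\lambda}\mathrm{inv}(\sigma)+\Delta$. Let $p_2(\Delta)$ be the number of partitions of $\Delta$ into positive parts each of which has one of two colors (so $p_2(0)=1$, $p_2(1)=2$, $p_2(2)=5$). Theorem. Let $\lambda\vdash n$ have exactly two columns, with conjugate partition $\lambda'=(s,r)$, $s\ge r\ge 1$, and let $0\le\Delta<r$. Then $\min_{\sigma\in W_\lambda}\mathrm{inv}(\sigma)=\binom s2+\binom r2$, and $$w_\lambda^\Delta=\begin{cases}p_2(\Delta) & \text{if } s=r,\\ 2\,p_2(\Delta) & \text{if } s>r.\end{cases}$$ -/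

import Mathlib

/-! ### Row insertion and the shape of a permutation -/

/-- Row insertion of `x` into one (strictly increasing) row. The leftmost entry larger than `x`,
which in an increasing row is the smallest such entry, is replaced by `x` and returned as the bumped
entry; if there is none, `x` is added at the end of the row and nothing is bumped. -/
def insertIntoRow {α : Type*} [LinearOrder α] (x : α) : List α → List α × Option α
  | [] => ([x], none)
  | y :: ys =>
    if x < y then (x :: ys, some y)
    else (y :: (insertIntoRow x ys).1, (insertIntoRow x ys).2)

/-- Row insertion `T ← x` into a tableau, given as the list of its rows from top to bottom:
insert `x` into the first row and, as long as an entry is bumped, insert the bumped entry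
into the next row, creating a new row at the bottom if necessary. -/
def rowInsert {α : Type*} [LinearOrder α] : List (List α) → α → List (List α)
  | [], x => [[x]]
  | row :: rows, x =>
    match insertIntoRow x row with
    | (row', none) => row' :: rows
    | (row', some y) => row' :: rowInsert rows y

/-- The Robinson-Schensted insertion tableau of a permutation `π`: the entries
of the one-line notation of `π` are row-inserted from left to right into the empty tableau. -/
def insertionTableau {n : ℕ} (π : Equiv.Perm (Fin n)) : List (List (Fin n)) :=
  (List.ofFn fun i => π i).foldl rowInsert []

/-- The list of row lengths of the shape of `π` under the Robinson-Schensted correspondence. -/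
def rsShape {n : ℕ} (π : Equiv.Perm (Fin n)) : List ℕ :=
  (insertionTableau π).map List.length

/-- The number of inversions of a permutation. -/
def invCount {n : ℕ} (π : Equiv.Perm (Fin n)) : ℕ :=
  (Finset.univ.filter fun p : Fin n × Fin n => p.1 < p.2 ∧ π p.2 < π p.1).card

/-- `W_μ`: the permutations in `S_n` whose shape is `μ`. -/
def permsOfShape (n : ℕ) (μ : YoungDiagram) : Set (Equiv.Perm (Fin n)) :=
  {π | rsShape π = μ.rowLens}

/-- The minimal number of inversions of a permutation in `S_n` of shape `μ`. -/
noncomputable def minInvCount (n : ℕ) (μ : YoungDiagram) : ℕ :=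
  sInf (invCount '' permsOfShape n μ)

/-- `W_μ^Δ`: the permutations in `S_n` of shape `μ` with exactly `Δ` more inversions than the
minimal ones. -/
def permsOfShapeExcess (n : ℕ) (μ : YoungDiagram) (Δ : ℕ) : Set (Equiv.Perm (Fin n)) :=
  {π ∈ permsOfShape n μ | invCount π = minInvCount n μ + Δ}

/-! ### Colored partitions -/

/-- A partition of `n` into parts of `c` colors: a finite multiset of
pairs (positive part, color) whose parts add up to `n`. -/
@[ext]
structure ColoredPartition (c n : ℕ) where
  parts : Multiset (ℕ × Fin c)
  parts_pos : ∀ x ∈ parts, 0 < x.1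
  parts_sum : (parts.map Prod.fst).sum = n

/-- There are only finitely many `c`-colored partitions of `n`. -/
instance ColoredPartition.instFinite (c n : ℕ) : Finite (ColoredPartition c n) := by
  have key : ∀ p : ColoredPartition c n,
      p.parts ≤ n • (Finset.range (n + 1) ×ˢ (Finset.univ : Finset (Fin c))).val := by
    intro p
    have hle : ∀ x ∈ p.parts, x.1 ≤ n := fun x hx =>
      (Multiset.le_sum_of_mem (Multiset.mem_map_of_mem Prod.fst hx)).trans_eq p.parts_sum
    have hcard : p.parts.card ≤ n := by
      have h := Multiset.card_nsmul_le_sum (s := p.parts.map Prod.fst) (a := 1) (by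
        intro y hy
        obtain ⟨x, hx, rfl⟩ := Multiset.mem_map.1 hy
        exact p.parts_pos x hx)
      simpa [p.parts_sum] using h
    rw [Multiset.le_iff_count]
    intro x
    by_cases hx : x ∈ p.parts
    · rw [Multiset.count_nsmul, Multiset.count_eq_one_of_mem (Finset.nodup _)]
      · simpa using (Multiset.count_le_card x p.parts).trans hcard
      · exact Finset.mem_product.2
          ⟨Finset.mem_range.2 (Nat.lt_succ_of_le (hle x hx)), Finset.mem_univ _⟩
    · simp [Multiset.count_eq_zero_of_notMem hx]
  exact Finite.of_injective
    (fun p => (⟨p.parts, key p⟩ :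
      Set.Iic (n • (Finset.range (n + 1) ×ˢ (Finset.univ : Finset (Fin c))).val)))
    (fun p q h => ColoredPartition.ext (congrArg Subtype.val h))

/-- `p_c(n)`: the number of partitions of `n` into parts of `c` colors. -/
noncomputable def coloredPartitionCount (c n : ℕ) : ℕ :=
  Nat.card (ColoredPartition c n)

/-! By Schensted's theorem, a permutation of s + r letters has column lengths s ≥ r exactly when it
has no increasing subsequence of length three and its longest decreasing subsequences have length s
(`rsShape_eq_iff`). Such a π is a union of two decreasing sequences, so its non-inversions all run
between them. Comparison with a longest decreasing subsequence bounds their number by s * r, which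
gives the minimum. If fewer than r of them are missing, some r-set X and its complement are both
decreasing (`IsTwoColumn.nonInvCount_bound`).

The excess Δ is then the number of inversions between X and Xᶜ. Since Δ < r, some point of X takes
part in none of them, and this forces X or Xᶜ to be `Separated` (`AntiOnBoth.separated_or`). For a
separated set, a cross inversion comes either from the order of positions or from the order of
values, never from both, so Δ splits as `subsetInv X` plus `subsetInv` of π(X). Conversely, two sets
X, Y of equal size r or s with this total Δ determine π, and X is recovered as `ascentStarts π`.

It remains to count pairs of sets. An a-subset of a + b points with k inversions is a partition of k
inside an a by b box, and the box is no constraint when k ≤ a and k ≤ b. A pair is thus a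
two-colored partition of Δ. The sizes r and s give two disjoint families if s > r and the same
family if s = r, whence the factor 2 or 1. -/

section Lists

/-! ### Chains in words -/

variable {α : Type*}

/-- `w` has a subword of length `k` that is pairwise related by `R`. -/
def HasChain (R : α → α → Prop) (k : ℕ) (w : List α) : Prop :=
  ∃ l : List α, l.Sublist w ∧ l.Pairwise R ∧ l.length = k

/-- The part of a chain inside a factor of the word interacts with the rest only through comparisons
with outside letters, so another block of the same length that respects the same outer bounds can
take its place. -/
theorem HasChain.replace {R : α → α → Prop} {k : ℕ} {a b u v : List α}
    (hab : ∀ l : List α, l.Sublist a → l.Pairwise R → ∃ l' : List α, l'.Sublist b ∧ l'.Pairwise R ∧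
      l'.length = l.length ∧ (∀ p, (∀ q ∈ l, R p q) → ∀ q ∈ l', R p q) ∧
        ∀ p, (∀ q ∈ l, R q p) → ∀ q ∈ l', R q p)
    (h : HasChain R k (u ++ a ++ v)) : HasChain R k (u ++ b ++ v) := by
  obtain ⟨l, hl, hR, hk⟩ := h
  obtain ⟨l₁₂, l₃, rfl, h12, h3⟩ := List.sublist_append_iff.1 hl
  obtain ⟨l₁, l₂, rfl, h1, h2⟩ := List.sublist_append_iff.1 h12
  simp only [List.pairwise_append, List.mem_append] at hR
  obtain ⟨⟨hR1, hR2, hR12⟩, hR3, hR13⟩ := hR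
  obtain ⟨l', hb, hR', hlen, hlo, hhi⟩ := hab l₂ h2 hR2
  refine ⟨l₁ ++ l' ++ l₃, (h1.append hb).append h3, ?_, by simpa [hlen] using hk⟩
  simp only [List.pairwise_append, List.mem_append]
  refine ⟨⟨hR1, hR', fun p hp => hlo p (hR12 p hp)⟩, hR3, ?_⟩
  rintro q (hq | hq) p hp
  · exact hR13 q (Or.inl hq) p hp
  · exact hhi p (fun q hq => hR13 q (Or.inr hq) p hp) q hq

theorem sublist_triple {l : List α} {x y z : α} (h : l.Sublist [x, y, z]) :
    l = [] ∨ l = [x] ∨ l = [y] ∨ l = [z] ∨ l = [x, y] ∨ l = [x, z] ∨ l = [y, z] ∨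
      l = [x, y, z] := by
  have := List.mem_sublists.2 h
  simp [List.sublists] at this
  tauto

/-- The reading word of a tableau: its rows from bottom to top. -/
def readingWord : List (List α) → List α
  | [] => []
  | row :: rows => readingWord rows ++ row

theorem length_readingWord (T : List (List α)) :
    (readingWord T).length = (T.map List.length).sum := by
  induction T with
  | nil => rfl
  | cons row rows ih => simp [readingWord, ih, add_comm]

theorem countP_add_countP_le {p q m : α → Bool} (l : List α)
    (h : ∀ x, (p x = true → q x = false ∧ m x = true) ∧ (q x = true → m x = true)) :
    l.countP p + l.countP q ≤ l.countP m := by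
  induction l with
  | nil => simp
  | cons x l ih =>
    have := h x
    simp only [List.countP_cons]
    cases hp : p x <;> cases hq : q x <;> cases hm : m x <;> simp_all <;> omega

/-! ### Knuth transformations and their invariants -/

variable [LinearOrder α]

/-- One elementary Knuth transformation, for words with possibly repeated letters. -/
inductive KnuthStep : List α → List α → Prop
  | left (u v : List α) (x y z : α) (hxy : x < y) (hyz : y ≤ z) :
      KnuthStep (u ++ y :: z :: x :: v) (u ++ y :: x :: z :: v)
  | right (u v : List α) (x y z : α) (hyx : y ≤ x) (hxz : x < z) :
      KnuthStep (u ++ y :: z :: x :: v) (u ++ z :: y :: x :: v)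

/-- Reachability by Knuth transformations. -/
def KnuthReach : List α → List α → Prop := Relation.ReflTransGen KnuthStep

theorem KnuthStep.append_both {a b : List α} (h : KnuthStep a b) (u v : List α) :
    KnuthStep (u ++ a ++ v) (u ++ b ++ v) := by
  cases h with
  | left u' v' x y z h1 h2 => simpa using KnuthStep.left (u ++ u') (v' ++ v) x y z h1 h2
  | right u' v' x y z h1 h2 => simpa using KnuthStep.right (u ++ u') (v' ++ v) x y z h1 h2

theorem KnuthReach.append_both {a b : List α} (h : KnuthReach a b) (u v : List α) :
    KnuthReach (u ++ a ++ v) (u ++ b ++ v) :=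
  Relation.ReflTransGen.lift (fun l => u ++ l ++ v)
    (fun _ _ h => KnuthStep.append_both h u v) _ _ h

theorem KnuthReach.trans {a b c : List α} (h : KnuthReach a b) (h' : KnuthReach b c) :
    KnuthReach a c := Relation.ReflTransGen.trans h h'

theorem KnuthReach.append_left {a b : List α} (h : KnuthReach a b) (u : List α) :
    KnuthReach (u ++ a) (u ++ b) := by simpa using h.append_both u []

theorem KnuthReach.append_right {a b : List α} (h : KnuthReach a b) (v : List α) :
    KnuthReach (a ++ v) (b ++ v) := by simpa using h.append_both [] v

theorem KnuthReach.perm {a b : List α} (h : KnuthReach a b) : a.Perm b := by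
  induction h with
  | refl => exact List.Perm.refl _
  | tail _ h ih =>
    refine ih.trans ?_
    cases h with
    | left u v x y z _ _ => exact ((List.Perm.swap x z v).cons y).append_left u
    | right u v x y z _ _ => exact (List.Perm.swap z y (x :: v)).append_left u

/-- Only a chain through both swapped letters can be destroyed. The third letter, whose value lies
between theirs, then replaces one of them. Weakly increasing chains are treated in the same way. -/
theorem KnuthStep.hasChain_gt {a b : List α} (h : KnuthStep a b) (k : ℕ) :
    HasChain (· > ·) k a ↔ HasChain (· > ·) k b := by
  cases h with
  | left u v x y z hxy hyz =>
    rw [show u ++ y :: z :: x :: v = u ++ [y, z, x] ++ v by simp,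
      show u ++ y :: x :: z :: v = u ++ [y, x, z] ++ v by simp]
    constructor <;> refine HasChain.replace fun l hl hR => ?_
    · rcases sublist_triple hl with rfl | rfl | rfl | rfl | rfl | rfl | rfl | rfl
      · exact ⟨[], by simp⟩
      · exact ⟨[y], by simp⟩
      · exact ⟨[z], by simp⟩
      · exact ⟨[x], by simp⟩
      · simp at hR; order
      · exact ⟨[y, x], by simp [hxy]⟩
      · refine ⟨[y, x], by simp, by simp [hxy], rfl, ?_, ?_⟩ <;> simp <;> intros <;> constructor <;> order
      · simp at hR; order
    · rcases sublist_triple hl with rfl | rfl | rfl | rfl | rfl | rfl | rfl | rfl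
      · exact ⟨[], by simp⟩
      · exact ⟨[y], by simp⟩
      · exact ⟨[x], by simp⟩
      · exact ⟨[z], by simp⟩
      · exact ⟨[y, x], by simp [hxy]⟩
      · simp at hR; order
      · simp at hR; order
      · simp at hR; order
  | right u v x y z hyx hxz =>
    rw [show u ++ y :: z :: x :: v = u ++ [y, z, x] ++ v by simp,
      show u ++ z :: y :: x :: v = u ++ [z, y, x] ++ v by simp]
    constructor <;> refine HasChain.replace fun l hl hR => ?_
    · rcases sublist_triple hl with rfl | rfl | rfl | rfl | rfl | rfl | rfl | rfl
      · exact ⟨[], by simp⟩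
      · exact ⟨[y], by simp⟩
      · exact ⟨[z], by simp⟩
      · exact ⟨[x], by simp⟩
      · simp at hR; order
      · simp at hR; order
      · exact ⟨[z, x], by simp [hxz]⟩
      · simp at hR; order
    · rcases sublist_triple hl with rfl | rfl | rfl | rfl | rfl | rfl | rfl | rfl
      · exact ⟨[], by simp⟩
      · exact ⟨[z], by simp⟩
      · exact ⟨[y], by simp⟩
      · exact ⟨[x], by simp⟩
      · refine ⟨[z, x], by simp, by simp [hxz], rfl, ?_, ?_⟩ <;> simp <;> intros <;> constructor <;> order
      · exact ⟨[z, x], by simp [hxz]⟩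
      · simp at hR; order
      · simp at hR; order

theorem KnuthStep.hasChain_le {a b : List α} (h : KnuthStep a b) (k : ℕ) :
    HasChain (· ≤ ·) k a ↔ HasChain (· ≤ ·) k b := by
  cases h with
  | left u v x y z hxy hyz =>
    rw [show u ++ y :: z :: x :: v = u ++ [y, z, x] ++ v by simp,
      show u ++ y :: x :: z :: v = u ++ [y, x, z] ++ v by simp]
    constructor <;> refine HasChain.replace fun l hl hR => ?_
    · rcases sublist_triple hl with rfl | rfl | rfl | rfl | rfl | rfl | rfl | rfl
      · exact ⟨[], by simp⟩
      · exact ⟨[y], by simp⟩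
      · exact ⟨[z], by simp⟩
      · exact ⟨[x], by simp⟩
      · exact ⟨[y, z], by simp [hyz]⟩
      · simp at hR; order
      · simp at hR; order
      · simp at hR; order
    · rcases sublist_triple hl with rfl | rfl | rfl | rfl | rfl | rfl | rfl | rfl
      · exact ⟨[], by simp⟩
      · exact ⟨[y], by simp⟩
      · exact ⟨[x], by simp⟩
      · exact ⟨[z], by simp⟩
      · simp at hR; order
      · exact ⟨[y, z], by simp [hyz]⟩
      · refine ⟨[y, z], by simp, by simp [hyz], rfl, ?_, ?_⟩ <;> simp <;> intros <;> constructor <;> order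
      · simp at hR; order
  | right u v x y z hyx hxz =>
    rw [show u ++ y :: z :: x :: v = u ++ [y, z, x] ++ v by simp,
      show u ++ z :: y :: x :: v = u ++ [z, y, x] ++ v by simp]
    constructor <;> refine HasChain.replace fun l hl hR => ?_
    · rcases sublist_triple hl with rfl | rfl | rfl | rfl | rfl | rfl | rfl | rfl
      · exact ⟨[], by simp⟩
      · exact ⟨[y], by simp⟩
      · exact ⟨[z], by simp⟩
      · exact ⟨[x], by simp⟩
      · refine ⟨[y, x], by simp, by simp [hyx], rfl, ?_, ?_⟩ <;> simp <;> intros <;> constructor <;> order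
      · exact ⟨[y, x], by simp [hyx]⟩
      · simp at hR; order
      · simp at hR; order
    · rcases sublist_triple hl with rfl | rfl | rfl | rfl | rfl | rfl | rfl | rfl
      · exact ⟨[], by simp⟩
      · exact ⟨[z], by simp⟩
      · exact ⟨[y], by simp⟩
      · exact ⟨[x], by simp⟩
      · simp at hR; order
      · simp at hR; order
      · exact ⟨[y, x], by simp [hyx]⟩
      · simp at hR; order

theorem KnuthReach.hasChain_gt {a b : List α} (h : KnuthReach a b) (k : ℕ) :
    HasChain (· > ·) k a ↔ HasChain (· > ·) k b := by
  induction h with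
  | refl => rfl
  | tail _ h ih => exact ih.trans (h.hasChain_gt k)

theorem KnuthReach.hasChain_le {a b : List α} (h : KnuthReach a b) (k : ℕ) :
    HasChain (· ≤ ·) k a ↔ HasChain (· ≤ ·) k b := by
  induction h with
  | refl => rfl
  | tail _ h ih => exact ih.trans (h.hasChain_le k)

/-- First half of a bump: x travels left until it stands next to y. In `KnuthReach.move_to_front`
the bumped y then leaves through the front of the row, where the reading word of the lower rows
ends. -/
theorem KnuthReach.move_left {x y : α} {b : List α} (hxy : x < y)
    (hb : (y :: b).Pairwise (· ≤ ·)) : KnuthReach (y :: b ++ [x]) (y :: x :: b) := by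
  induction b generalizing y with
  | nil => exact Relation.ReflTransGen.refl
  | cons c b ih =>
    have hyc : y ≤ c := (List.pairwise_cons.1 hb).1 c (by simp)
    have h1 := (ih (hxy.trans_le hyc) (List.pairwise_cons.1 hb).2).append_left [y]
    exact h1.tail (KnuthStep.left [] b x y c hxy hyc)

theorem KnuthReach.move_to_front {x y : α} {a : List α} (b : List α) (hxy : x < y)
    (ha : a.Pairwise (· ≤ ·)) (hax : ∀ z ∈ a, z ≤ x) :
    KnuthReach (a ++ y :: x :: b) (y :: a ++ x :: b) := by
  induction a with
  | nil => exact Relation.ReflTransGen.refl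
  | cons c a ih =>
    have hca := List.pairwise_cons.1 ha
    have h1 := (ih hca.2 fun z hz => hax z (by simp [hz])).append_left [c]
    refine h1.tail ?_
    cases a with
    | nil => exact KnuthStep.right [] b x c y (hax c (by simp)) hxy
    | cons e a =>
      exact KnuthStep.right [] (a ++ x :: b) e c y (hca.1 e (by simp))
        ((hax e (by simp)).trans_lt hxy)

/-! ### Row insertion, tableaux and reading words -/

theorem insertIntoRow_cases (x : α) (row : List α) :
    (insertIntoRow x row = (row ++ [x], none) ∧ ∀ z ∈ row, z ≤ x) ∨
      ∃ a y b, row = a ++ y :: b ∧ insertIntoRow x row = (a ++ x :: b, some y) ∧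
        (∀ z ∈ a, z ≤ x) ∧ x < y := by
  induction row with
  | nil => left; simp [insertIntoRow]
  | cons c row ih =>
    by_cases hxc : x < c
    · right
      exact ⟨[], c, row, by simp [insertIntoRow, hxc]⟩
    · rcases ih with ⟨h1, h2⟩ | ⟨a, y, b, rfl, h1, h2, h3⟩
      · left
        simp only [insertIntoRow, hxc, if_false, h1]
        simpa using ⟨not_lt.1 hxc, h2⟩
      · right
        refine ⟨c :: a, y, b, rfl, by simp [insertIntoRow, hxc, h1], ?_, h3⟩
        simpa using ⟨not_lt.1 hxc, h2⟩

theorem knuthReach_rowInsert {T : List (List α)} (hT : ∀ row ∈ T, row.Pairwise (· ≤ ·)) (x : α) :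
    KnuthReach (readingWord T ++ [x]) (readingWord (rowInsert T x)) := by
  induction T generalizing x with
  | nil => exact Relation.ReflTransGen.refl
  | cons row rows ih =>
    rcases insertIntoRow_cases x row with ⟨h1, -⟩ | ⟨a, y, b, rfl, h1, h2, h3⟩
    · simp only [rowInsert, h1, readingWord, List.append_assoc]
      exact Relation.ReflTransGen.refl
    · simp only [rowInsert, h1, readingWord]
      have hs := hT _ List.mem_cons_self
      have hs' := List.pairwise_append.1 hs
      have e1 : KnuthReach (a ++ y :: b ++ [x]) (a ++ y :: x :: b) := by
        simpa using (KnuthReach.move_left h3 hs'.2.1).append_left a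
      have e2 := (e1.trans (KnuthReach.move_to_front b h3 hs'.1 h2)).append_left
        (readingWord rows)
      have e3 := (ih (fun r hr => hT r (List.mem_cons_of_mem _ hr)) y).append_right (a ++ x :: b)
      simp only [List.append_assoc, List.cons_append, List.nil_append] at e2 e3 ⊢
      exact e2.trans e3

/-- `upper` strictly dominates `lower` column by column, expressed by counting entries. -/
def RowDominates (upper lower : List α) : Prop :=
  ∀ t, lower.countP (fun z => decide (z ≤ t)) ≤ upper.countP (fun z => decide (z < t))

/-- Semistandard tableaux: rows weakly increasing, columns strictly increasing. -/
def IsTableau : List (List α) → Prop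
  | [] => True
  | row :: rows => row ≠ [] ∧ row.Pairwise (· ≤ ·) ∧ RowDominates row (rows.headD []) ∧
      IsTableau rows

theorem IsTableau.sorted {T : List (List α)} (hT : IsTableau T) :
    ∀ row ∈ T, row.Pairwise (· ≤ ·) := by
  induction T with
  | nil => simp
  | cons row rows ih =>
    intro r hr
    rcases List.mem_cons.1 hr with rfl | hr
    · exact hT.2.1
    · exact ih hT.2.2.2 r hr

/-- Only t ≥ y is at stake, where y is newly counted below. Either a bumped entry ≤ t leaves in
exchange, or the lower entries ≤ t other than y are all ≤ y. The hypothesis at y bounds the number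
of the latter by the length of a, and above, a together with x supplies one more entry. -/
theorem RowDominates.bump {a b lower : List α} {x y : α} (hs : (a ++ y :: b).Pairwise (· ≤ ·))
    (hax : ∀ z ∈ a, z ≤ x) (hxy : x < y) (hl : lower.Pairwise (· ≤ ·))
    (h : RowDominates (a ++ y :: b) lower) :
    RowDominates (a ++ x :: b) (insertIntoRow y lower).1 := by
  intro t
  have ht := h t
  have hy := h y
  have hb : ∀ z ∈ b, y ≤ z := (List.pairwise_cons.1 (List.pairwise_append.1 hs).2.1).1
  have ca : a.countP (fun z => decide (z < y)) = a.length :=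
    List.countP_eq_length.2 fun z hz => by simpa using (hax z hz).trans_lt hxy
  have cb : b.countP (fun z => decide (z < y)) = 0 :=
    List.countP_eq_zero.2 fun z hz => by simpa using hb z hz
  have ca' : y ≤ t → a.countP (fun z => decide (z < t)) = a.length := fun hyt =>
    List.countP_eq_length.2 fun z hz => by simpa using ((hax z hz).trans_lt hxy).trans_le hyt
  simp only [List.countP_append, List.countP_cons, ca, cb, lt_self_iff_false, decide_false] at ht hy
  rcases insertIntoRow_cases y lower with ⟨h1, h2⟩ | ⟨a', z, b', rfl, h1, h2, h3⟩
  · rw [h1]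
    have cl : lower.countP (fun z => decide (z ≤ y)) = lower.length :=
      List.countP_eq_length.2 fun z hz => by simpa using h2 z hz
    have cl' := List.countP_le_length (p := fun z => decide (z ≤ t)) (l := lower)
    simp only [List.countP_append, List.countP_cons, List.countP_nil]
    by_cases hyt : y ≤ t
    · have := ca' hyt
      have hxt : x < t := hxy.trans_le hyt
      simp [hyt, hxt, this]
      simp at hy
      omega
    · have : ¬ y < t := fun h => hyt h.le
      simp [hyt, this] at ht ⊢
      omega
  · rw [h1]
    have hl' := List.pairwise_append.1 hl
    have hb' : ∀ w ∈ b', z ≤ w := (List.pairwise_cons.1 hl'.2.1).1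
    have cl : a'.countP (fun z => decide (z ≤ y)) = a'.length :=
      List.countP_eq_length.2 fun z hz => by simpa using h2 z hz
    have cl' := List.countP_le_length (p := fun z => decide (z ≤ t)) (l := a')
    simp only [List.countP_append, List.countP_cons] at ht hy ⊢
    by_cases hyt : y ≤ t
    · have hxt : x < t := hxy.trans_le hyt
      by_cases hzt : z ≤ t
      · have hyt' : y < t := h3.trans_le hzt
        simp [hyt, hxt, hzt, hyt'] at ht ⊢
        omega
      · have cb'' : b'.countP (fun z => decide (z ≤ t)) = 0 :=
          List.countP_eq_zero.2 fun w hw => by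
            simpa using (not_le.1 hzt).trans_le (hb' w hw)
        have := ca' hyt
        simp [hyt, hxt, this, cb'']
        simp at hy
        omega
    · have : ¬ y < t := fun h => hyt h.le
      simp [hyt, this] at ht ⊢
      omega

theorem IsTableau.rowInsert {T : List (List α)} (hT : IsTableau T) (x : α) :
    IsTableau (rowInsert T x) := by
  induction T generalizing x with
  | nil => simp [_root_.rowInsert, IsTableau, RowDominates]
  | cons row rows ih =>
    obtain ⟨hne, hs, hd, hr⟩ := hT
    rcases insertIntoRow_cases x row with ⟨h1, h2⟩ | ⟨a, y, b, rfl, h1, h2, h3⟩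
    · simp only [_root_.rowInsert, h1]
      refine ⟨by simp, ?_, fun t => (hd t).trans ?_, hr⟩
      · rw [List.pairwise_append]
        exact ⟨hs, by simp, by simpa using h2⟩
      · simp
    · simp only [_root_.rowInsert, h1]
      refine ⟨by simp, ?_, ?_, ih hr y⟩
      · simp only [List.pairwise_append, List.pairwise_cons, List.mem_cons] at hs ⊢
        obtain ⟨ha, ⟨hyb, hb⟩, hab⟩ := hs
        refine ⟨ha, ⟨fun z hz => h3.le.trans (hyb z hz), hb⟩, ?_⟩
        rintro z hz w (rfl | hw)
        · exact h2 z hz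
        · exact hab z hz w (Or.inr hw)
      · have key := hd.bump hs h2 h3 (by
          cases rows with
          | nil => simp
          | cons r rs => exact hr.2.1)
        cases rows with
        | nil => simpa [_root_.rowInsert, insertIntoRow] using key
        | cons r rs =>
          rcases insertIntoRow_cases y r with ⟨h1, -⟩ | ⟨a, z, b, -, h1, -, -⟩ <;>
            simpa [_root_.rowInsert, h1] using key

theorem IsTableau.foldl_rowInsert (w : List α) :
    IsTableau (w.foldl _root_.rowInsert []) ∧
      KnuthReach w (readingWord (w.foldl _root_.rowInsert [])) := by
  induction w using List.reverseRecOn with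
  | nil => exact ⟨trivial, Relation.ReflTransGen.refl⟩
  | append_singleton w x ih =>
    rw [List.foldl_append]
    exact ⟨ih.1.rowInsert x,
      (ih.2.append_right [x]).trans (knuthReach_rowInsert ih.1.sorted x)⟩

/-! ### Longest chains and the first row and column -/

theorem IsTableau.hasChain_gt_length {T : List (List α)} (hT : IsTableau T) :
    HasChain (· > ·) T.length (readingWord T) := by
  -- The chain is made to end at the least entry of the top row, so that the head of a further row
  -- on top can extend it.
  suffices h : ∀ row rows, IsTableau (row :: rows) → ∃ l y, y ∈ row ∧ (∀ z ∈ row, y ≤ z) ∧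
      (l ++ [y]).Sublist (readingWord (row :: rows)) ∧ (l ++ [y]).Pairwise (· > ·) ∧
        l.length = rows.length by
    cases T with
    | nil => exact ⟨[], by simp⟩
    | cons row rows =>
      obtain ⟨l, y, -, -, h1, h2, h3⟩ := h row rows hT
      exact ⟨_, h1, h2, by simp [h3]⟩
  intro row rows
  induction rows generalizing row with
  | nil =>
    intro hT
    cases row with
    | nil => exact absurd rfl hT.1
    | cons y row =>
      refine ⟨[], y, by simp, ?_, by simp [readingWord], by simp, rfl⟩
      have := (List.pairwise_cons.1 hT.2.1).1
      simpa using this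
  | cons next rows ih =>
    intro hT
    obtain ⟨l, y, hy, hmin, hl, hR, hlen⟩ := ih next hT.2.2.2
    cases row with
    | nil => exact absurd rfl hT.1
    | cons x row =>
      have hx : ∀ z ∈ row, x ≤ z := (List.pairwise_cons.1 hT.2.1).1
      have hxy : x < y := by
        have h1 : 0 < next.countP (fun z => decide (z ≤ y)) :=
          List.countP_pos_iff.2 ⟨y, hy, by simp⟩
        obtain ⟨z, hz, hzy⟩ := List.countP_pos_iff.1 (h1.trans_le (hT.2.2.1 y))
        have hzy : z < y := by simpa using hzy
        rcases List.mem_cons.1 hz with rfl | hz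
        · exact hzy
        · exact (hx z hz).trans_lt hzy
      refine ⟨l ++ [y], x, by simp, by simpa using hx, ?_, ?_, by simp [hlen]⟩
      · exact hl.append (by simp)
      · rw [List.pairwise_append]
        refine ⟨hR, by simp, ?_⟩
        rw [List.pairwise_append] at hR
        simp only [List.mem_append, List.mem_singleton]
        rintro a (ha | rfl) b rfl
        · exact hxy.trans (hR.2.2 a ha y (by simp))
        · exact hxy

/-- A strictly decreasing word takes at most one letter from each weakly increasing row. -/
theorem HasChain.le_length_of_sorted {T : List (List α)}
    (hT : ∀ row ∈ T, row.Pairwise (· ≤ ·)) {k : ℕ} (h : HasChain (· > ·) k (readingWord T)) :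
    k ≤ T.length := by
  induction T generalizing k with
  | nil =>
    obtain ⟨l, hl, -, rfl⟩ := h
    simp [readingWord] at hl
    simp [hl]
  | cons row rows ih =>
    obtain ⟨l, hl, hR, rfl⟩ := h
    obtain ⟨l₁, l₂, rfl, h1, h2⟩ := List.sublist_append_iff.1 hl
    rw [List.pairwise_append] at hR
    have := ih (fun r hr => hT r (List.mem_cons_of_mem _ hr)) ⟨l₁, h1, hR.1, rfl⟩
    have hle := (hT row List.mem_cons_self).sublist h2
    have : l₂.length ≤ 1 := by
      match l₂, hle, hR.2.1 with
      | [], _, _ => simp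
      | [_], _, _ => simp
      | a :: b :: l, hle, hgt =>
        simp only [List.pairwise_cons, List.mem_cons] at hle hgt
        exact absurd (hgt.1 b (Or.inl rfl)) (not_lt.2 (hle.1 b (Or.inl rfl)))
    simp only [List.length_append, List.length_cons]
    omega

/-- Let m be the last letter taken from the lower rows. By induction and column strictness, the
letters up to m are at most as many as the top-row entries < m. The others are top-row entries
between m and t. The bound t is what carries the induction. -/
theorem IsTableau.length_le_countP {T : List (List α)} (hT : IsTableau T) {l : List α}
    (hl : l.Sublist (readingWord T)) (hR : l.Pairwise (· ≤ ·)) {t : α} (ht : ∀ z ∈ l, z ≤ t) :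
    l.length ≤ (T.headD []).countP (fun z => decide (z ≤ t)) := by
  induction T generalizing l t with
  | nil =>
    simp [readingWord] at hl
    simp [hl]
  | cons row rows ih =>
    obtain ⟨l₁, l₂, rfl, h1, h2⟩ := List.sublist_append_iff.1 hl
    rw [List.pairwise_append] at hR
    obtain ⟨hR1, hR2, hR12⟩ := hR
    rcases List.eq_nil_or_concat' l₁ with rfl | ⟨l₀, m, rfl⟩
    · have : l₂.countP (fun z => decide (z ≤ t)) = l₂.length :=
        List.countP_eq_length.2 fun z hz => by simpa using ht z (by simpa using hz)
      simpa [← this] using h2.countP_le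
    · have c1 := ih hT.2.2.2 h1 hR1 (t := m) (by
        intro z hz
        rw [List.pairwise_append] at hR1
        simp only [List.mem_append, List.mem_singleton] at hz
        rcases hz with hz | rfl
        · exact hR1.2.2 z hz m (by simp)
        · exact le_rfl)
      have c2 := hT.2.2.1 m
      have c3 : l₂.countP (fun z => decide (m ≤ z ∧ z ≤ t)) = l₂.length :=
        List.countP_eq_length.2 fun z hz => by
          simpa using ⟨hR12 m (by simp) z hz, ht z (by simp [hz])⟩
      have c4 : l₂.countP (fun z => decide (m ≤ z ∧ z ≤ t)) ≤ _ := h2.countP_le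
      have hm : m ≤ t := ht m (by simp)
      have c5 := countP_add_countP_le (p := fun z => decide (z < m))
        (q := fun z => decide (m ≤ z ∧ z ≤ t)) (m := fun z => decide (z ≤ t)) row (by
          intro z
          simp only [decide_eq_true_eq, decide_eq_false_iff_not]
          exact ⟨fun h => ⟨fun h' => (h.trans_le h'.1).false, h.le.trans hm⟩, fun h => h.2⟩)
      rw [List.length_append]
      simp only [List.headD_cons]
      omega

theorem IsTableau.le_head_length {T : List (List α)} (hT : IsTableau T) {k : ℕ}
    (h : HasChain (· ≤ ·) k (readingWord T)) : k ≤ (T.headD []).length := by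
  obtain ⟨l, hl, hR, rfl⟩ := h
  rcases List.eq_nil_or_concat' l with rfl | ⟨l₀, m, rfl⟩
  · simp
  · refine (hT.length_le_countP hl hR (t := m) ?_).trans List.countP_le_length
    intro z hz
    rw [List.pairwise_append] at hR
    simp only [List.mem_append, List.mem_singleton] at hz
    rcases hz with hz | rfl
    · exact hR.2.2 z hz m (by simp)
    · exact le_rfl

theorem IsTableau.hasChain_le_head {T : List (List α)} (hT : IsTableau T) :
    HasChain (· ≤ ·) (T.headD []).length (readingWord T) := by
  cases T with
  | nil => exact ⟨[], by simp⟩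
  | cons row rows => exact ⟨row, List.sublist_append_right _ _, hT.2.1, rfl⟩

theorem RowDominates.length_le {a b : List α} (h : RowDominates a b)
    (hb : b.Pairwise (· ≤ ·)) : b.length ≤ a.length := by
  rcases List.eq_nil_or_concat' b with rfl | ⟨l₀, m, rfl⟩
  · simp
  · have := h m
    rw [List.countP_eq_length.2] at this
    · exact this.trans List.countP_le_length
    · intro z hz
      rw [List.pairwise_append] at hb
      simp only [List.mem_append, List.mem_singleton] at hz
      rcases hz with hz | rfl
      · simpa using hb.2.2 z hz m (by simp)
      · simp

/-- The shape of a tableau with at most two columns. -/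
theorem IsTableau.shape_of_head_le_two {T : List (List α)} (hT : IsTableau T)
    (h : (T.headD []).length ≤ 2) :
    ∃ p q, T.map List.length = List.replicate p 2 ++ List.replicate q 1 := by
  induction T with
  | nil => exact ⟨0, 0, rfl⟩
  | cons row rows ih =>
    have h0 : 0 < row.length := List.length_pos_iff.2 hT.1
    have hle : (rows.headD []).length ≤ row.length := hT.2.2.1.length_le (by
      cases rows with
      | nil => simp
      | cons r rs => exact hT.2.2.2.2.1)
    simp only [List.headD_cons] at h
    obtain ⟨p, q, hpq⟩ := ih hT.2.2.2 (hle.trans h)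
    rcases (by omega : row.length = 1 ∨ row.length = 2) with h1 | h2
    · cases p with
      | zero => exact ⟨0, q + 1, by simp [hpq, h1, List.replicate_succ]⟩
      | succ p =>
        exfalso
        cases rows with
        | nil => simp at hpq
        | cons r rs =>
          simp [List.replicate_succ] at hpq hle
          omega
    · exact ⟨p + 1, q, by simp [hpq, h2, List.replicate_succ]⟩

end Lists

/-! ### Schensted's theorem for two-column shapes -/

theorem hasChain_ofFn_iff {n k : ℕ} (R : Fin n → Fin n → Prop) (π : Equiv.Perm (Fin n)) :
    HasChain R k (List.ofFn fun i => π i) ↔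
      ∃ A : Finset (Fin n), A.card = k ∧ ∀ i ∈ A, ∀ j ∈ A, i < j → R (π i) (π j) := by
  rw [List.ofFn_eq_map]
  constructor
  · rintro ⟨l, hl, hR, rfl⟩
    obtain ⟨l', hl', rfl⟩ := List.sublist_map_iff.1 hl
    have hlt : l'.Pairwise (· < ·) := (List.pairwise_lt_finRange n).sublist hl'
    have hnd : l'.Nodup := hlt.imp fun h => h.ne
    refine ⟨l'.toFinset, by simp [List.toFinset_card_of_nodup hnd], ?_⟩
    rw [List.pairwise_map] at hR
    intro i hi j hj hij
    rw [List.mem_toFinset, List.mem_iff_getElem] at hi hj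
    obtain ⟨a, ha, rfl⟩ := hi
    obtain ⟨b, hb, rfl⟩ := hj
    rw [List.pairwise_iff_getElem] at hR hlt
    rcases lt_trichotomy a b with h | h | h
    · exact hR a b ha hb h
    · subst h; exact absurd hij (lt_irrefl _)
    · exact absurd hij (hlt b a hb ha h).not_gt
  · rintro ⟨A, rfl, hA⟩
    refine ⟨(A.sort (· ≤ ·)).map π, ?_, ?_, by simp⟩
    · refine List.Sublist.map _ (List.sublist_of_subperm_of_pairwise (r := (· < ·)) ?_ ?_ ?_)
      · exact List.subperm_of_subset (A.sort_nodup _) (fun x _ => List.mem_finRange x)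
      · exact A.sortedLT_sort.pairwise
      · exact List.pairwise_lt_finRange n
    · rw [List.pairwise_map]
      exact (A.sortedLT_sort.pairwise).imp_of_mem fun {a b} ha hb hab =>
        hA a (by simpa using ha) b (by simpa using hb) hab

/-- Chain lengths survive the passage to the reading word, where they measure the first row and the
number of rows. With first row at most 2, the number of rows and the number of boxes fix the shape.
-/
theorem rsShape_eq_iff {n s r : ℕ} (hn : n = s + r) (hr : 1 ≤ r) (hrs : r ≤ s)
    (π : Equiv.Perm (Fin n)) :
    rsShape π = List.replicate r 2 ++ List.replicate (s - r) 1 ↔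
      (∀ i j k, i < j → j < k → π i < π j → π j < π k → False) ∧
      (∃ A : Finset (Fin n), A.card = s ∧ StrictAntiOn π A) ∧
      ∀ A : Finset (Fin n), StrictAntiOn π A → A.card ≤ s := by
  obtain ⟨hT, hK⟩ := IsTableau.foldl_rowInsert (List.ofFn fun i => π i)
  change IsTableau (insertionTableau π) at hT
  change KnuthReach _ (readingWord (insertionTableau π)) at hK
  have hgt : ∀ k, HasChain (· > ·) k (readingWord (insertionTableau π)) ↔
      ∃ A : Finset (Fin n), A.card = k ∧ StrictAntiOn π A := fun k => by
    rw [← hK.hasChain_gt, hasChain_ofFn_iff]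
    exact exists_congr fun A => and_congr Iff.rfl
      ⟨fun h i hi j hj hij => h i hi j hj hij, fun h i hi j hj hij => h hi hj hij⟩
  have hle : ∀ k, HasChain (· ≤ ·) k (readingWord (insertionTableau π)) ↔
      ∃ A : Finset (Fin n), A.card = k ∧ ∀ i ∈ A, ∀ j ∈ A, i < j → π i ≤ π j := fun k => by
    rw [← hK.hasChain_le, hasChain_ofFn_iff]
  have hlen : ((insertionTableau π).map List.length).sum = n := by
    rw [← length_readingWord, ← hK.perm.length_eq, List.length_ofFn]
  have hmax : ∀ A : Finset (Fin n), StrictAntiOn π A → A.card ≤ (insertionTableau π).length :=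
    fun A hA => HasChain.le_length_of_sorted hT.sorted ((hgt _).2 ⟨A, rfl, hA⟩)
  have hex := (hgt _).1 hT.hasChain_gt_length
  constructor
  · intro hsh
    have hl : (insertionTableau π).length = s := by
      have := congrArg List.length hsh
      simp [rsShape] at this
      omega
    rw [hl] at hmax hex
    refine ⟨fun i j k hij hjk h1 h2 => ?_, hex, hmax⟩
    have h3 := hT.le_head_length ((hle 3).2 ⟨{i, j, k}, ?_, ?_⟩)
    · unfold rsShape at hsh
      obtain ⟨r, rfl⟩ : ∃ r', r = r' + 1 := ⟨r - 1, by omega⟩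
      cases hi : insertionTableau π with
      | nil => simp [hi] at h3
      | cons row rows =>
        simp [hi, List.replicate_succ] at h3 hsh
        omega
    · rw [Finset.card_eq_three]
      exact ⟨i, j, k, hij.ne, (hij.trans hjk).ne, hjk.ne, rfl⟩
    · simp only [Finset.mem_insert, Finset.mem_singleton]
      rintro a (rfl | rfl | rfl) b (rfl | rfl | rfl) hab <;> order
  · rintro ⟨h123, ⟨A, hAs, hA⟩, hmax'⟩
    have hl : (insertionTableau π).length = s := by
      obtain ⟨B, hB, hB'⟩ := hex
      exact le_antisymm (hB ▸ hmax' B hB') (hAs ▸ hmax A hA)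
    have h2 : ((insertionTableau π).headD []).length ≤ 2 := by
      by_contra! h
      obtain ⟨A, hA, hA'⟩ := (hle _).1 hT.hasChain_le_head
      obtain ⟨B, hBA, hB⟩ := Finset.exists_subset_card_eq (hA.symm ▸ h : 2 < A.card)
      obtain ⟨i, j, k, hij, hjk, rfl⟩ : ∃ i j k, i < j ∧ j < k ∧ B = {i, j, k} := by
        refine ⟨B.orderEmbOfFin hB 0, B.orderEmbOfFin hB 1, B.orderEmbOfFin hB 2, by simp, by simp, ?_⟩
        ext x
        rw [← Finset.mem_coe, ← Finset.range_orderEmbOfFin B hB, Set.mem_range]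
        simp only [Finset.mem_insert, Finset.mem_singleton, Fin.exists_fin_succ]
        simp [eq_comm]
      have lt : ∀ a ∈ A, ∀ b ∈ A, a < b → π a < π b := fun a ha b hb hab =>
        (hA' a ha b hb hab).lt_of_ne fun h => hab.ne (π.injective h)
      exact h123 i j k hij hjk (lt i (hBA (by simp)) j (hBA (by simp)) hij)
        (lt j (hBA (by simp)) k (hBA (by simp)) hjk)
    obtain ⟨p, q, hpq⟩ := hT.shape_of_head_le_two h2
    have e1 := congrArg List.length hpq
    rw [hpq] at hlen
    simp [hl] at e1 hlen
    unfold rsShape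
    rw [hpq, show p = r by omega, show q = s - r by omega]

/-! ### Subsets as partitions in a box -/

section Subsets

/-- The number of pairs `(c, d)` with `c ∈ X`, `d ∉ X` and `d < c`. -/
def subsetInv {n : ℕ} (X : Finset (Fin n)) : ℕ :=
  ((X ×ˢ Xᶜ).filter fun p => p.2 < p.1).card

/-- The multiset of the nonzero numbers `#{d ∉ X | d < c}` for `c ∈ X`. -/
def gapMultiset {n : ℕ} (X : Finset (Fin n)) : Multiset ℕ :=
  (X.val.map fun c => (Xᶜ.filter (· < c)).card).filter (0 < ·)

theorem sum_filter_pos (M : Multiset ℕ) : (M.filter (0 < ·)).sum = M.sum := by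
  induction M using Multiset.induction_on with
  | empty => rfl
  | cons a M ih =>
    rcases Nat.eq_zero_or_pos a with rfl | h
    · simp [ih]
    · simp [h, ih]

theorem eq_filter_pos_add_replicate (M : Multiset ℕ) :
    M = M.filter (0 < ·) + Multiset.replicate (M.card - (M.filter (0 < ·)).card) 0 := by
  have h := Multiset.filter_add_not (0 < ·) M
  have h2 : M.filter (fun a => ¬ 0 < a) =
      Multiset.replicate (M.filter (fun a => ¬ 0 < a)).card 0 :=
    Multiset.eq_replicate_card.2 fun b hb => by
      have := (Multiset.mem_filter.1 hb).2
      omega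
  have h3 := congrArg Multiset.card h
  rw [Multiset.card_add] at h3
  rw [show M.card - (M.filter (0 < ·)).card = (M.filter (fun a => ¬ 0 < a)).card by omega, ← h2, h]

theorem sum_gapMultiset {n : ℕ} (X : Finset (Fin n)) : (gapMultiset X).sum = subsetInv X := by
  rw [gapMultiset, sum_filter_pos, subsetInv, Finset.card_filter, Finset.sum_product]
  simp only [Finset.card_filter]
  rfl

theorem card_compl_filter_lt {n a : ℕ} {X : Finset (Fin n)} (h : X.card = a) (i : Fin a) :
    (Xᶜ.filter (· < X.orderEmbOfFin h i)).card = X.orderEmbOfFin h i - i := by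
  set c := X.orderEmbOfFin h i
  have h1 : (X.filter (· < c)).card = i := by
    have : X.filter (· < c) = (Finset.Iio i).map (X.orderEmbOfFin h).toEmbedding := by
      ext x
      simp only [Finset.mem_filter, Finset.mem_map, Finset.mem_Iio, RelEmbedding.coe_toEmbedding]
      constructor
      · rintro ⟨hx, hlt⟩
        rw [← Finset.mem_coe, ← Finset.range_orderEmbOfFin X h] at hx
        obtain ⟨j, rfl⟩ := hx
        exact ⟨j, by simpa [c] using hlt, rfl⟩
      · rintro ⟨j, hj, rfl⟩
        exact ⟨Finset.orderEmbOfFin_mem X h j, by simpa [c] using hj⟩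
    rw [this, Finset.card_map, Fin.card_Iio]
  have h2 : (X.filter (· < c)).card + (Xᶜ.filter (· < c)).card = c := by
    rw [← Finset.card_union_of_disjoint, ← Finset.filter_union, Finset.union_compl]
    · rw [← Fin.card_Iio c]
      congr 1
      ext x
      simp
    · exact Finset.disjoint_filter_filter disjoint_compl_right
  omega

theorem map_gap_eq {n a : ℕ} {X : Finset (Fin n)} (h : X.card = a) :
    (X.val.map fun c => (Xᶜ.filter (· < c)).card) =
      ((List.ofFn fun i : Fin a => (X.orderEmbOfFin h i : ℕ) - i : List ℕ) : Multiset ℕ) := by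
  have : X.val = Multiset.map (X.orderEmbOfFin h) (Finset.univ : Finset (Fin a)).val := by
    conv_lhs => rw [← Finset.map_orderEmbOfFin_univ X h]
    rfl
  conv_lhs => rw [this]
  rw [Multiset.map_map, List.ofFn_eq_map, ← Multiset.map_coe]
  have e : ((List.finRange a : List (Fin a)) : Multiset (Fin a)) = Finset.univ.val := rfl
  rw [e]
  exact Multiset.map_congr rfl fun i _ => card_compl_filter_lt h i

theorem le_of_strictMono {a n : ℕ} {f : Fin a → Fin n} (hf : StrictMono f) (i : Fin a) :
    (i : ℕ) ≤ f i := by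
  obtain ⟨i, hi⟩ := i
  induction i with
  | zero => simp
  | succ i ih =>
    have h1 := ih (by omega)
    have h2 : f ⟨i, by omega⟩ < f ⟨i + 1, hi⟩ := hf (by simp)
    rw [Fin.lt_def] at h2
    simp only at h1 ⊢
    omega

theorem sub_monotone_of_strictMono {a n : ℕ} {f : Fin a → Fin n} (hf : StrictMono f) :
    Monotone fun i : Fin a => (f i : ℕ) - i := by
  suffices h : ∀ (k i : ℕ) (hk : i + k < a),
      (f ⟨i, by omega⟩ : ℕ) + k ≤ f ⟨i + k, hk⟩ by
    intro i j hij
    have := h (j - i) i (by omega)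
    have e : (⟨(i : ℕ) + (j - i), by omega⟩ : Fin a) = j := Fin.ext (by simp; omega)
    rw [e] at this
    simp only [Fin.eta] at this ⊢
    omega
  intro k i
  induction k with
  | zero => simp
  | succ k ih =>
    intro hk
    have h1 := ih (by omega)
    have h2 : f ⟨i + k, by omega⟩ < f ⟨i + (k + 1), hk⟩ := hf (by simp)
    rw [Fin.lt_def] at h2
    omega

/-- The cardinality restores the discarded zero gaps. The i-th element minus i is weakly increasing
in i, so the multiset of gaps determines their list, hence the set. -/
theorem gapMultiset_injective {n : ℕ} {X Y : Finset (Fin n)} (hc : X.card = Y.card)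
    (h : gapMultiset X = gapMultiset Y) : X = Y := by
  have h1 : (X.val.map fun c => (Xᶜ.filter (· < c)).card) =
      Y.val.map fun c => (Yᶜ.filter (· < c)).card := by
    rw [eq_filter_pos_add_replicate (X.val.map _), eq_filter_pos_add_replicate (Y.val.map _)]
    unfold gapMultiset at h
    rw [h, Multiset.card_map, Multiset.card_map, Finset.card_val, Finset.card_val, hc]
  rw [map_gap_eq rfl, map_gap_eq hc.symm, Multiset.coe_eq_coe] at h1
  have h2 := h1.eq_of_pairwise' (r := (· ≤ ·))
    (List.pairwise_ofFn.2 fun i j hij =>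
      sub_monotone_of_strictMono (X.orderEmbOfFin rfl).strictMono hij.le)
    (List.pairwise_ofFn.2 fun i j hij =>
      sub_monotone_of_strictMono (Y.orderEmbOfFin hc.symm).strictMono hij.le)
  have h3 := List.ofFn_injective h2
  have h4 : ⇑(X.orderEmbOfFin rfl) = Y.orderEmbOfFin hc.symm := by
    funext i
    have e := congrFun h3 i
    have l1 := le_of_strictMono (X.orderEmbOfFin rfl).strictMono i
    have l2 := le_of_strictMono (Y.orderEmbOfFin hc.symm).strictMono i
    simp only at e
    exact Fin.ext (by omega)
  rw [← Finset.coe_inj, ← Finset.range_orderEmbOfFin X rfl,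
    ← Finset.range_orderEmbOfFin Y hc.symm, h4]

/-- Pad M with zeros to a parts, sort, and add i to the i-th part. No part exceeds b, so the values
stay below a + b. -/
theorem exists_gapMultiset_eq {n a b : ℕ} (hn : n = a + b) {M : Multiset ℕ}
    (hpos : ∀ x ∈ M, 0 < x) (ha : M.sum ≤ a) (hb : M.sum ≤ b) :
    ∃ X : Finset (Fin n), X.card = a ∧ gapMultiset X = M := by
  have hcard : M.card ≤ M.sum := by
    simpa using Multiset.card_nsmul_le_sum (s := M) (a := 1) fun x hx => hpos x hx
  set N := M + Multiset.replicate (a - M.card) 0 with hN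
  have hNa : N.card = a := by simp [hN]; omega
  set l := N.sort (· ≤ ·) with hl
  have hla : l.length = a := by simp [hl, hNa]
  have hle : ∀ x ∈ l, x ≤ b := by
    intro x hx
    have hx : x ∈ N := by simpa [hl] using hx
    have : x ≤ N.sum := Multiset.le_sum_of_mem hx
    simp [hN] at this
    omega
  have hsort : l.Pairwise (· ≤ ·) := Multiset.pairwise_sort _ _
  let g : Fin a → Fin n := fun i => ⟨l[i]'(by omega) + i, by
    have := hle (l[i]'(by omega)) (List.getElem_mem _)
    omega⟩
  have hg : StrictMono g := by
    intro i j hij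
    have := List.pairwise_iff_getElem.1 hsort i j (by omega) (by omega) hij
    simp only [g, Fin.lt_def, Fin.getElem_fin] at hij ⊢
    omega
  have hX : (Finset.univ.image g).card = a := by
    rw [Finset.card_image_of_injective _ hg.injective, Finset.card_univ, Fintype.card_fin]
  refine ⟨Finset.univ.image g, hX, ?_⟩
  have hge : g = (Finset.univ.image g).orderEmbOfFin hX :=
    Finset.orderEmbOfFin_unique hX (fun i => by simp) hg
  rw [gapMultiset, map_gap_eq hX, ← hge]
  have : (List.ofFn fun i : Fin a => (g i : ℕ) - i) = l := by
    apply List.ext_getElem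
    · simp [hla]
    · intro i h1 h2
      simp [g]
  rw [this, hl, Multiset.sort_eq, hN, Multiset.filter_add, Multiset.filter_eq_self.2 hpos]
  simp only [Multiset.filter_eq_nil, Multiset.mem_replicate, add_eq_left]
  rintro x ⟨-, rfl⟩
  simp

/-- Pairs of `a`-subsets of `Fin n` with total number of inversions `k`. -/
def subsetPairs (n a k : ℕ) : Finset (Finset (Fin n) × Finset (Fin n)) :=
  Finset.univ.filter fun p => p.1.card = a ∧ p.2.card = a ∧ subsetInv p.1 + subsetInv p.2 = k

/-- Glue two multisets to a two-colored one. -/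
def colorPair (M N : Multiset ℕ) : Multiset (ℕ × Fin 2) :=
  M.map (fun x => (x, 0)) + N.map fun x => (x, 1)

/-- The entries of color `c`. -/
def colorPart (c : Fin 2) (P : Multiset (ℕ × Fin 2)) : Multiset ℕ :=
  (P.filter fun x => x.2 = c).map Prod.fst

theorem colorPart_zero_colorPair (M N : Multiset ℕ) : colorPart 0 (colorPair M N) = M := by
  simp [colorPart, colorPair, Multiset.filter_add, Multiset.filter_map]

theorem colorPart_one_colorPair (M N : Multiset ℕ) : colorPart 1 (colorPair M N) = N := by
  simp [colorPart, colorPair, Multiset.filter_add, Multiset.filter_map]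

theorem colorPair_colorPart (P : Multiset (ℕ × Fin 2)) :
    colorPair (colorPart 0 P) (colorPart 1 P) = P := by
  induction P using Multiset.induction_on with
  | empty => rfl
  | cons p P ih =>
    obtain ⟨x, c⟩ := p
    simp only [colorPair, colorPart] at ih ⊢
    fin_cases c
    · simpa using ih
    · simpa [Multiset.add_cons] using ih

theorem sum_colorPair (M N : Multiset ℕ) :
    ((colorPair M N).map Prod.fst).sum = M.sum + N.sum := by
  simp [colorPair]

theorem card_subsetPairs {n a b k : ℕ} (hn : n = a + b) (ha : k ≤ a) (hb : k ≤ b) :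
    (subsetPairs n a k).card = coloredPartitionCount 2 k := by
  rw [coloredPartitionCount, ← Nat.card_eq_finsetCard]
  have hmem : ∀ p : subsetPairs n a k, p.1.1.card = a ∧ p.1.2.card = a ∧
      subsetInv p.1.1 + subsetInv p.1.2 = k := fun p => by simpa [subsetPairs] using p.2
  let f : subsetPairs n a k → ColoredPartition 2 k := fun p =>
    { parts := colorPair (gapMultiset p.1.1) (gapMultiset p.1.2)
      parts_pos := by
        intro x hx
        rw [colorPair, Multiset.mem_add, Multiset.mem_map, Multiset.mem_map] at hx
        rcases hx with ⟨y, hy, rfl⟩ | ⟨y, hy, rfl⟩ <;> exact (Multiset.mem_filter.1 hy).2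
      parts_sum := by
        rw [sum_colorPair, sum_gapMultiset, sum_gapMultiset, (hmem p).2.2] }
  refine Nat.card_eq_of_bijective f ⟨fun p q h => ?_, fun P => ?_⟩
  · have h : colorPair (gapMultiset p.1.1) (gapMultiset p.1.2) =
        colorPair (gapMultiset q.1.1) (gapMultiset q.1.2) := congrArg ColoredPartition.parts h
    have h0 := congrArg (colorPart 0) h
    have h1 := congrArg (colorPart 1) h
    rw [colorPart_zero_colorPair, colorPart_zero_colorPair] at h0
    rw [colorPart_one_colorPair, colorPart_one_colorPair] at h1
    exact Subtype.ext (Prod.ext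
      (gapMultiset_injective ((hmem p).1.trans (hmem q).1.symm) h0)
      (gapMultiset_injective ((hmem p).2.1.trans (hmem q).2.1.symm) h1))
  · have hs : (colorPart 0 P.parts).sum + (colorPart 1 P.parts).sum = k := by
      rw [← sum_colorPair, colorPair_colorPart, P.parts_sum]
    have hpos : ∀ c, ∀ x ∈ colorPart c P.parts, 0 < x := by
      intro c x hx
      obtain ⟨y, hy, rfl⟩ := Multiset.mem_map.1 hx
      exact P.parts_pos y (Multiset.mem_filter.1 hy).1
    obtain ⟨X, hX, hX'⟩ := exists_gapMultiset_eq hn (hpos 0) (by omega) (by omega)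
    obtain ⟨Y, hY, hY'⟩ := exists_gapMultiset_eq hn (hpos 1) (by omega) (by omega)
    refine ⟨⟨(X, Y), ?_⟩, ?_⟩
    · simp [subsetPairs, hX, hY, ← sum_gapMultiset, hX', hY', hs]
    · apply ColoredPartition.ext
      simp only [f, hX', hY', colorPair_colorPart]

end Subsets

/-! ### Inversions between two decreasing sequences -/

section CrossInversions

variable {n : ℕ}

/-- The number of pairs of positions whose values are in increasing order. -/
def nonInvCount (π : Equiv.Perm (Fin n)) : ℕ :=
  (Finset.univ.filter fun p : Fin n × Fin n => p.1 < p.2 ∧ π p.1 < π p.2).card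

theorem card_filter_fst_lt_snd (n : ℕ) :
    (Finset.univ.filter fun p : Fin n × Fin n => p.1 < p.2).card = n.choose 2 := by
  rw [Finset.card_filter, Fintype.sum_prod_type_right]
  simp only [← Finset.card_filter]
  have : ∀ j : Fin n, (Finset.univ.filter fun i => i < j).card = (j : ℕ) := fun j => by
    rw [← Fin.card_Iio j]
    congr 1
    ext x
    simp
  simp only [this]
  rw [Fin.sum_univ_eq_sum_range (fun i => i), Finset.sum_range_id, Nat.choose_two_right]

theorem invCount_add_nonInvCount (π : Equiv.Perm (Fin n)) :
    invCount π + nonInvCount π = n.choose 2 := by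
  rw [← card_filter_fst_lt_snd, invCount, nonInvCount, ← Finset.card_union_of_disjoint]
  · congr 1
    ext p
    simp only [Finset.mem_union, Finset.mem_filter, Finset.mem_univ, true_and]
    constructor
    · rintro (h | h) <;> exact h.1
    · intro h
      rcases lt_trichotomy (π p.1) (π p.2) with h' | h' | h'
      · exact Or.inr ⟨h, h'⟩
      · exact absurd (π.injective h') h.ne
      · exact Or.inl ⟨h, h'⟩
  · rw [Finset.disjoint_filter]
    rintro p - ⟨-, h⟩ ⟨-, h'⟩
    exact h.not_gt h'

/-- `c` and `d` form an inversion of `π`, in either order. -/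
def IsInverted (π : Equiv.Perm (Fin n)) (c d : Fin n) : Prop :=
  (c < d ∧ π d < π c) ∨ (d < c ∧ π c < π d)

instance (π : Equiv.Perm (Fin n)) (c d : Fin n) : Decidable (IsInverted π c d) :=
  inferInstanceAs (Decidable (_ ∨ _))

theorem not_isInverted_iff {π : Equiv.Perm (Fin n)} {c d : Fin n} (h : c ≠ d) :
    ¬ IsInverted π c d ↔ (c < d ∧ π c < π d) ∨ (d < c ∧ π d < π c) := by
  have := π.injective.ne h
  unfold IsInverted
  constructor
  · intro h'
    rcases lt_or_gt_of_ne h with h1 | h1 <;> rcases lt_or_gt_of_ne this with h2 | h2 <;> tauto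
  · rintro (⟨h1, h2⟩ | ⟨h1, h2⟩) (⟨h3, h4⟩ | ⟨h3, h4⟩) <;> order

/-- The number of inversions of `π` between `X` and its complement. -/
def crossInv (π : Equiv.Perm (Fin n)) (X : Finset (Fin n)) : ℕ :=
  ((X ×ˢ Xᶜ).filter fun p => IsInverted π p.1 p.2).card

/-- `π` is decreasing on `X` and on its complement. -/
def AntiOnBoth (π : Equiv.Perm (Fin n)) (X : Finset (Fin n)) : Prop :=
  StrictAntiOn π X ∧ StrictAntiOn π (Xᶜ : Finset (Fin n))

theorem AntiOnBoth.compl {π : Equiv.Perm (Fin n)} {X : Finset (Fin n)} (h : AntiOnBoth π X) :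
    AntiOnBoth π Xᶜ := ⟨h.2, by rw [compl_compl]; exact h.1⟩

theorem AntiOnBoth.mem_iff_notMem {π : Equiv.Perm (Fin n)} {X : Finset (Fin n)}
    (h : AntiOnBoth π X) {i j : Fin n} (hij : i < j) (hπ : π i < π j) : i ∈ X ↔ j ∉ X := by
  constructor
  · intro hi hj
    exact (h.1 hi hj hij).not_gt hπ
  · intro hj
    by_contra hi
    exact (h.2 (by simpa using hi) (by simpa using hj) hij).not_gt hπ

/-- A non-inversion has exactly one end in X. The bijection lists its ends by membership in X one
way and by position the other way. -/
theorem AntiOnBoth.nonInvCount_add {π : Equiv.Perm (Fin n)} {X : Finset (Fin n)}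
    (h : AntiOnBoth π X) : nonInvCount π + crossInv π X = X.card * Xᶜ.card := by
  rw [← Finset.card_product,
    ← Finset.card_filter_add_card_filter_not (s := X ×ˢ Xᶜ) (fun p => IsInverted π p.1 p.2), add_comm]
  congr 1
  refine Finset.card_nbij' (fun p => if p.1 ∈ X then p else p.swap)
    (fun p => if p.1 < p.2 then p else p.swap) ?_ ?_ ?_ ?_
  · rintro ⟨i, j⟩ hp
    simp only [Finset.coe_filter, Finset.mem_univ, true_and, Set.mem_ofPred_eq, Finset.mem_product,
      Finset.mem_compl] at hp ⊢
    have hm := h.mem_iff_notMem hp.1 hp.2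
    by_cases hi : i ∈ X
    · simp only [hi, if_true]
      exact ⟨⟨trivial, hm.1 hi⟩, (not_isInverted_iff hp.1.ne).2 (Or.inl hp)⟩
    · simp only [hi, if_false, Prod.swap]
      refine ⟨⟨by tauto, by simp⟩, (not_isInverted_iff hp.1.ne').2 (Or.inr hp)⟩
  · rintro ⟨c, d⟩ hp
    simp only [Finset.coe_filter, Finset.mem_univ, true_and, Set.mem_ofPred_eq, Finset.mem_product,
      Finset.mem_compl] at hp ⊢
    have hne : c ≠ d := fun e => hp.1.2 (e ▸ hp.1.1)
    rcases (not_isInverted_iff hne).1 hp.2 with h1 | h1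
    · simpa [h1.1] using h1.2
    · simpa [h1.1.not_gt, h1.1] using h1.2
  · rintro ⟨i, j⟩ hp
    simp only [Finset.coe_filter, Finset.mem_univ, true_and, Set.mem_ofPred_eq] at hp
    by_cases hi : i ∈ X
    · simp [hi, hp.1]
    · simp [hi, hp.1.not_gt]
  · rintro ⟨c, d⟩ hp
    simp only [Finset.coe_filter, Set.mem_ofPred_eq, Finset.mem_product,
      Finset.mem_compl] at hp
    by_cases hcd : c < d
    · simp [hcd, hp.1.1]
    · simp [hcd, hp.1.2]

theorem crossInv_compl (π : Equiv.Perm (Fin n)) (X : Finset (Fin n)) :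
    crossInv π Xᶜ = crossInv π X := by
  refine Finset.card_nbij' Prod.swap Prod.swap ?_ ?_ ?_ ?_ <;> rintro ⟨c, d⟩
  · simp only [Finset.coe_filter, Set.mem_ofPred_eq, Finset.mem_product, Finset.mem_compl,
      Prod.swap]
    unfold IsInverted
    tauto
  · simp only [Finset.coe_filter, Set.mem_ofPred_eq, Finset.mem_product, Finset.mem_compl,
      Prod.swap]
    unfold IsInverted
    tauto
  · simp
  · simp

/-- No element of `X` lies to the right of and above an element outside `X`. -/
def Separated (π : Equiv.Perm (Fin n)) (X : Finset (Fin n)) : Prop :=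
  ∀ c ∈ X, ∀ d ∉ X, d < c → ¬ π d < π c

theorem subsetInv_map (π : Equiv.Perm (Fin n)) (X : Finset (Fin n)) :
    subsetInv (X.map π.toEmbedding) = ((X ×ˢ Xᶜ).filter fun p => π p.2 < π p.1).card := by
  rw [subsetInv]
  refine Finset.card_nbij' (fun p => (π.symm p.1, π.symm p.2)) (fun p => (π p.1, π p.2)) ?_ ?_ ?_ ?_
    <;> rintro ⟨c, d⟩ <;> simp

/-- For c ∈ X and d ∉ X, an inversion means that exactly one of d < c and π d < π c holds;
separation excludes both at once. -/
theorem Separated.crossInv_eq {π : Equiv.Perm (Fin n)} {X : Finset (Fin n)}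
    (h : Separated π X) : crossInv π X = subsetInv X + subsetInv (X.map π.toEmbedding) := by
  rw [subsetInv_map, subsetInv, crossInv, ← Finset.card_union_of_disjoint]
  · congr 1
    ext ⟨c, d⟩
    simp only [Finset.mem_union, Finset.mem_filter, Finset.mem_product, Finset.mem_compl, ← and_or_left]
    refine and_congr_right fun ⟨hc, hd⟩ => ?_
    have h1 := h c hc d hd
    have hne : c ≠ d := fun e => hd (e ▸ hc)
    have hne' := π.injective.ne hne
    unfold IsInverted
    constructor
    · tauto
    · rintro (h2 | h2)
      · exact Or.inr ⟨h2, lt_of_le_of_ne (not_lt.1 (h1 h2)) hne'⟩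
      · exact Or.inl ⟨lt_of_le_of_ne (not_lt.1 fun h3 => h1 h3 h2) hne, h2⟩
  · rw [Finset.disjoint_filter]
    rintro ⟨c, d⟩ hcd h1 h2
    simp only [Finset.mem_product, Finset.mem_compl] at hcd
    exact h c hcd.1 d hcd.2 h1 h2

/-- Suppose c ∈ X lies right of and above d ∉ X. With d, each element of X from c on contributes to
the first term and each one up to c to the second. As c counts twice, the total exceeds the size of
X. -/
theorem Separated.of_subsetInv_le {π : Equiv.Perm (Fin n)} {X : Finset (Fin n)}
    (hX : StrictAntiOn π X)
    (h : subsetInv X + subsetInv (X.map π.toEmbedding) ≤ X.card) : Separated π X := by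
  intro c hc d hd hdc hπ
  rw [subsetInv_map, subsetInv] at h
  have h1 : (X.filter (c ≤ ·)).card ≤ ((X ×ˢ Xᶜ).filter fun p => p.2 < p.1).card := by
    refine Finset.card_le_card_of_injOn (fun c' => (c', d)) ?_ fun x _ y _ hxy => (Prod.ext_iff.1 hxy).1
    intro c' hc'
    simp only [Finset.coe_filter, Set.mem_ofPred_eq] at hc'
    simpa [hd, hc'.1] using hdc.trans_le hc'.2
  have h2 : (X.filter (· ≤ c)).card ≤ ((X ×ˢ Xᶜ).filter fun p => π p.2 < π p.1).card := by
    refine Finset.card_le_card_of_injOn (fun c' => (c', d)) ?_ fun x _ y _ hxy => (Prod.ext_iff.1 hxy).1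
    intro c' hc'
    simp only [Finset.coe_filter, Set.mem_ofPred_eq] at hc'
    have : π c ≤ π c' := hX.antitoneOn hc'.1 hc hc'.2
    simpa [hd, hc'.1] using hπ.trans_le this
  have h3 := Finset.card_union_add_card_inter (X.filter (c ≤ ·)) (X.filter (· ≤ c))
  have h4 : X.filter (c ≤ ·) ∪ X.filter (· ≤ c) = X := by
    ext x
    simp only [Finset.mem_union, Finset.mem_filter, ← and_or_left]
    exact and_iff_left (le_total c x)
  have h5 : 0 < (X.filter (c ≤ ·) ∩ X.filter (· ≤ c)).card :=
    Finset.card_pos.2 ⟨c, by simp [hc]⟩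
  rw [h4] at h3
  omega

theorem exists_forall_not_isInverted {π : Equiv.Perm (Fin n)} {X : Finset (Fin n)}
    (h : crossInv π X < X.card) : ∃ c ∈ X, ∀ d ∉ X, ¬ IsInverted π c d := by
  have h1 : (((X ×ˢ Xᶜ).filter fun p => IsInverted π p.1 p.2).image Prod.fst).card < X.card :=
    Finset.card_image_le.trans_lt h
  obtain ⟨c, hc, hc'⟩ := Finset.exists_mem_notMem_of_card_lt_card h1
  refine ⟨c, hc, fun d hd hcd => hc' ?_⟩
  exact Finset.mem_image.2 ⟨(c, d), by simp [hc, hd, hcd], rfl⟩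

/-- Some c ∈ X has every d ∉ X strictly to its upper right or lower left. Both kinds cannot occur,
since Xᶜ is decreasing. In either case a violation of separation would chain with c to an ascent
inside X. -/
theorem AntiOnBoth.separated_or {π : Equiv.Perm (Fin n)} {X : Finset (Fin n)}
    (hX : AntiOnBoth π X) (h : crossInv π X < X.card) : Separated π X ∨ Separated π Xᶜ := by
  obtain ⟨c, hc, hcd⟩ := exists_forall_not_isInverted h
  have hcd' : ∀ d ∉ X, (c < d ∧ π c < π d) ∨ (d < c ∧ π d < π c) := fun d hd =>
    (not_isInverted_iff (ne_of_mem_of_not_mem hc hd)).1 (hcd d hd)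
  by_cases hall : ∀ d ∉ X, c < d ∧ π c < π d
  · left
    intro c' hc' d hd h1 h2
    have h3 := hall d hd
    exact (hX.1 hc hc' (h3.1.trans h1)).not_gt (h3.2.trans h2)
  · right
    push Not at hall
    obtain ⟨d₀, hd₀, hd₀'⟩ := hall
    have h0 : d₀ < c ∧ π d₀ < π c := by
      rcases hcd' d₀ hd₀ with h1 | h1
      · exact absurd h1.2 (hd₀' h1.1).not_gt
      · exact h1
    intro d hd c' hc' h1 h2
    simp only [Finset.mem_compl, not_not] at hd hc'
    rcases hcd' d hd with h3 | h3
    · exact (hX.2 (by simpa using hd₀) (by simpa using hd) (h0.1.trans h3.1)).not_gt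
        (h0.2.trans h3.2)
    · exact (hX.1 hc' hc (h1.trans h3.1)).not_gt (h2.trans h3.2)

/-- The positions that start a pair of increasing values. -/
def ascentStarts (π : Equiv.Perm (Fin n)) : Finset (Fin n) :=
  Finset.univ.filter fun i => ∃ j, i < j ∧ π i < π j

/-- This makes X canonical. There are too few cross inversions for a point of X to be inverted with
all of Xᶜ, so it starts an ascent; an ascent starting outside X would end in X and break separation.
-/
theorem Separated.eq_ascentStarts {π : Equiv.Perm (Fin n)} {X : Finset (Fin n)}
    (hs : Separated π X) (hX : AntiOnBoth π X) (h : crossInv π X < Xᶜ.card) :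
    X = ascentStarts π := by
  ext i
  simp only [ascentStarts, Finset.mem_filter, Finset.mem_univ, true_and]
  constructor
  · intro hi
    rw [← crossInv_compl] at h
    have h1 : ∃ d ∉ X, ¬ IsInverted π i d := by
      by_contra! hall
      have : Xᶜ.card ≤ crossInv π Xᶜ := by
        refine Finset.card_le_card_of_injOn (fun d => (d, i)) ?_
          fun x _ y _ hxy => (Prod.ext_iff.1 hxy).1
        intro d hd
        have hd : d ∉ X := by simpa using hd
        have := hall d hd
        simp only [IsInverted] at this
        simp [hd, hi, IsInverted]
        tauto
      omega
    obtain ⟨d, hd, hid⟩ := h1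
    rcases (not_isInverted_iff (ne_of_mem_of_not_mem hi hd)).1 hid with h2 | h2
    · exact ⟨d, h2⟩
    · exact absurd h2.2 (hs i hi d hd h2.1)
  · rintro ⟨j, hij, hπ⟩
    by_contra hi
    have hj : j ∈ X := by
      by_contra hj
      exact hi ((hX.mem_iff_notMem hij hπ).2 hj)
    exact hs j hj i hi hij hπ

theorem StrictAntiOn.eqOn_of_map_eq {π σ : Equiv.Perm (Fin n)} {X : Finset (Fin n)}
    (hπ : StrictAntiOn π X) (hσ : StrictAntiOn σ X)
    (h : X.map π.toEmbedding = X.map σ.toEmbedding) : Set.EqOn π σ X := by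
  have h1 : StrictMono fun x : X => OrderDual.toDual (π x) := fun x y hxy => hπ x.2 y.2 hxy
  have h2 : StrictMono fun x : X => OrderDual.toDual (σ x) := fun x y hxy => hσ x.2 y.2 hxy
  have h3 := (h1.range_inj h2).1 (by
    ext y
    have := Finset.ext_iff.1 h (OrderDual.ofDual y)
    simp only [Finset.mem_map] at this
    simp only [Set.mem_range, Subtype.exists, exists_prop]
    exact this)
  intro x hx
  exact congrFun h3 ⟨x, hx⟩

theorem AntiOnBoth.eq_of_map_eq {π σ : Equiv.Perm (Fin n)} {X : Finset (Fin n)}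
    (hπ : AntiOnBoth π X) (hσ : AntiOnBoth σ X)
    (h : X.map π.toEmbedding = X.map σ.toEmbedding) : π = σ := by
  have h' : Xᶜ.map π.toEmbedding = Xᶜ.map σ.toEmbedding := by
    have e : ∀ τ : Equiv.Perm (Fin n), Xᶜ.map τ.toEmbedding = (X.map τ.toEmbedding)ᶜ := fun τ => by
      ext y
      simp [Finset.mem_map_equiv]
    rw [e, e, h]
  ext x : 1
  by_cases hx : x ∈ X
  · exact hπ.1.eqOn_of_map_eq hσ.1 h hx
  · exact hπ.2.eqOn_of_map_eq hσ.2 h' (by simpa using hx)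

theorem exists_antitone_equiv {X Y : Finset (Fin n)} (h : X.card = Y.card) :
    ∃ e : X ≃ Y, StrictAnti e := by
  refine ⟨((X.orderIsoOfFin rfl).symm.toEquiv.trans Fin.revPerm).trans
    (Y.orderIsoOfFin h.symm).toEquiv, fun x y hxy => ?_⟩
  simpa using hxy

theorem exists_antiOnBoth {X Y : Finset (Fin n)} (h : X.card = Y.card) :
    ∃ π : Equiv.Perm (Fin n), AntiOnBoth π X ∧ X.map π.toEmbedding = Y := by
  obtain ⟨e, he⟩ := exists_antitone_equiv h
  obtain ⟨e', he'⟩ := exists_antitone_equiv (X := Xᶜ) (Y := Yᶜ) (by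
    rw [Finset.card_compl, Finset.card_compl, h])
  let f : Fin n → Fin n := fun x => if hx : x ∈ X then e ⟨x, hx⟩ else
    e' ⟨x, Finset.mem_compl.2 hx⟩
  have f1 : ∀ x (hx : x ∈ X), f x = e ⟨x, hx⟩ := fun x hx => dif_pos hx
  have f2 : ∀ x (hx : x ∈ Xᶜ), f x = e' ⟨x, hx⟩ := fun x hx => dif_neg (Finset.mem_compl.1 hx)
  have hmem : ∀ x, f x ∈ Y ↔ x ∈ X := by
    intro x
    by_cases hx : x ∈ X
    · rw [f1 x hx]
      simp [hx]
    · rw [f2 x (by simpa using hx)]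
      have := (e' ⟨x, Finset.mem_compl.2 hx⟩).2
      rw [Finset.mem_compl] at this
      tauto
  have hf : Function.Injective f := by
    intro x y hxy
    by_cases hx : x ∈ X
    · have hy : y ∈ X := by rwa [← hmem, ← hxy, hmem]
      rw [f1 x hx, f1 y hy] at hxy
      simpa using e.injective (Subtype.ext hxy)
    · have hy : y ∉ X := by rwa [← hmem, ← hxy, hmem]
      rw [f2 x (by simpa using hx), f2 y (by simpa using hy)] at hxy
      simpa using e'.injective (Subtype.ext hxy)
  refine ⟨Equiv.ofBijective f hf.bijective_of_finite, ⟨?_, ?_⟩, ?_⟩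
  · intro x hx y hy hxy
    change f y < f x
    rw [f1 x hx, f1 y hy]
    exact he hxy
  · intro x hx y hy hxy
    change f y < f x
    rw [f2 x hx, f2 y hy]
    exact he' hxy
  · apply Finset.eq_of_subset_of_card_le
    · intro y hy
      obtain ⟨x, hx, rfl⟩ := Finset.mem_map.1 hy
      exact (hmem x).2 hx
    · rw [Finset.card_map, h]

end CrossInversions

/-! ### Two-column permutations of small excess -/

section TwoColumns

variable {n : ℕ}

/-- `π` has no increasing subsequence of length three, and its longest decreasing subsequences
have length `s`. -/
def IsTwoColumn (s : ℕ) (π : Equiv.Perm (Fin n)) : Prop :=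
  (∀ i j k, i < j → j < k → π i < π j → π j < π k → False) ∧
    (∃ A : Finset (Fin n), A.card = s ∧ StrictAntiOn π A) ∧
      ∀ A : Finset (Fin n), StrictAntiOn π A → A.card ≤ s

theorem IsTwoColumn.nonInvCount_bound {s r : ℕ} (hn : n = s + r) {π : Equiv.Perm (Fin n)}
    (h : IsTwoColumn s π) : nonInvCount π ≤ s * r ∧
      (s * r < nonInvCount π + r → ∃ X : Finset (Fin n), X.card = r ∧ AntiOnBoth π X) := by
  obtain ⟨h123, ⟨D, hDs, hD⟩, hmax⟩ := h
  have hA : StrictAntiOn π (ascentStarts π) := by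
    intro i hi j hj hij
    by_contra hlt
    have hlt : π i < π j := lt_of_le_of_ne (not_lt.1 hlt) (π.injective.ne hij.ne)
    simp only [ascentStarts, Finset.coe_filter, Finset.mem_univ, true_and, Set.mem_ofPred_eq] at hj
    obtain ⟨k, hjk, hk⟩ := hj
    exact h123 i j k hij hjk hlt hk
  have hB : StrictAntiOn π ((ascentStarts π)ᶜ : Finset (Fin n)) := by
    intro i hi j hj hij
    by_contra hlt
    have hlt : π i < π j := lt_of_le_of_ne (not_lt.1 hlt) (π.injective.ne hij.ne)
    simp [ascentStarts] at hi
    exact (hi j hij).not_gt hlt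
  set A := ascentStarts π with hAdef
  have cA := Finset.card_inter_add_card_sdiff A D
  have cB := Finset.card_inter_add_card_sdiff Aᶜ D
  have cD := Finset.card_inter_add_card_sdiff D A
  have eD : D \ A = Aᶜ ∩ D := by ext; simp; tauto
  rw [eD, Finset.inter_comm D A] at cD
  have cAc := Finset.card_compl A
  have cAn : A.card ≤ n := by simpa using Finset.card_le_univ A
  rw [Fintype.card_fin] at cAc
  have mA := hmax A hA
  have mB := hmax Aᶜ hB
  -- A non-inversion starts in A and, with no increasing triple, ends in Aᶜ; its ends cannot both
  -- lie in the decreasing set D.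
  have key : nonInvCount π + (A ∩ D).card * (Aᶜ ∩ D).card ≤ A.card * Aᶜ.card := by
    rw [nonInvCount, ← Finset.card_product, ← Finset.card_product, ← Finset.card_union_of_disjoint]
    · apply Finset.card_le_card
      rintro ⟨i, j⟩ hij
      simp only [Finset.mem_union, Finset.mem_filter, Finset.mem_univ, true_and,
        Finset.mem_product, Finset.mem_inter] at hij ⊢
      rcases hij with hij | hij
      · refine ⟨by simp only [hAdef, ascentStarts, Finset.mem_filter, Finset.mem_univ, true_and]
                   exact ⟨j, hij⟩, ?_⟩
        simp only [hAdef, ascentStarts, Finset.mem_compl, Finset.mem_filter, Finset.mem_univ,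
          true_and, not_exists]
        rintro k ⟨hjk, hk⟩
        exact h123 i j k hij.1 hjk hij.2 hk
      · exact ⟨hij.1.1, hij.2.1⟩
    · rw [Finset.disjoint_left]
      rintro ⟨i, j⟩ hij hij'
      simp only [Finset.mem_filter, Finset.mem_univ, true_and,
        Finset.mem_product, Finset.mem_inter] at hij hij'
      exact (hD hij'.1.2 hij'.2.2 hij.1).not_gt hij.2
  have Dc : Dᶜ.card = r := by
    rw [Finset.card_compl, Fintype.card_fin]
    omega
  rw [← cA, ← cB] at key
  have hr : r = (A \ D).card + (Aᶜ \ D).card := by omega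
  have ha : (A \ D).card ≤ (Aᶜ ∩ D).card := by omega
  have hb : (Aᶜ \ D).card ≤ (A ∩ D).card := by omega
  have hs : s = (A ∩ D).card + (Aᶜ ∩ D).card := by omega
  have trivA : (A \ D).card = 0 → ∃ X : Finset (Fin n), X.card = r ∧ AntiOnBoth π X := by
    intro h0
    rw [Finset.card_eq_zero, Finset.sdiff_eq_empty_iff_subset] at h0
    refine ⟨Dᶜ, Dc, hB.mono ?_, by rwa [compl_compl]⟩
    exact Finset.coe_subset.2 (Finset.compl_subset_compl.2 h0)
  have trivB : (Aᶜ \ D).card = 0 → ∃ X : Finset (Fin n), X.card = r ∧ AntiOnBoth π X := by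
    intro h0
    rw [Finset.card_eq_zero, Finset.sdiff_eq_empty_iff_subset] at h0
    refine ⟨Dᶜ, Dc, hA.mono ?_, by rwa [compl_compl]⟩
    exact Finset.coe_subset.2 (by rw [← compl_compl A]; exact Finset.compl_subset_compl.2 h0)
  have trivAB : A.card = r → ∃ X : Finset (Fin n), X.card = r ∧ AntiOnBoth π X :=
    fun h => ⟨A, h, hA, hB⟩
  rw [← cA] at trivAB
  generalize (A \ D).card = a at *
  generalize (Aᶜ \ D).card = b at *
  generalize (Aᶜ ∩ D).card = x at *
  generalize (A ∩ D).card = y at *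
  -- Here x' and y' are the slacks of A and Aᶜ below size s. In these terms `key` says that at least
  -- a * b + a * y' + b * x' of the s * r non-inversions are missing.
  obtain ⟨x', rfl⟩ := Nat.exists_eq_add_of_le ha
  obtain ⟨y', rfl⟩ := Nat.exists_eq_add_of_le hb
  subst hr
  have hsr : s * (a + b) = (b + y' + (a + x')) * (a + b) := by rw [hs]
  refine ⟨by nlinarith [Nat.zero_le (a * y'), Nat.zero_le (b * x'), Nat.zero_le (a * b)],
    fun hlt => ?_⟩
  have hlt' : a * b + a * y' + b * x' < a + b := by nlinarith
  rcases Nat.eq_zero_or_pos a with h0 | h0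
  · exact trivA h0
  rcases Nat.eq_zero_or_pos b with h1 | h1
  · exact trivB h1
  apply trivAB
  -- If y' = 0, then A itself has a + b = r elements. Otherwise a * b ≥ b and a * y' ≥ a contradict
  -- `hlt'`.
  rcases Nat.eq_zero_or_pos y' with h2 | h2
  · omega
  · exfalso
    nlinarith [Nat.mul_le_mul h0 (le_refl b), Nat.mul_le_mul (le_refl a) h2]

theorem AntiOnBoth.isTwoColumn {s r : ℕ} (hn : n = s + r) (hrs : r ≤ s)
    {π : Equiv.Perm (Fin n)} {X : Finset (Fin n)} (hX : AntiOnBoth π X)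
    (hc : X.card = r ∨ X.card = s) (h : crossInv π X < r) : IsTwoColumn s π := by
  have hcc := Finset.card_compl X
  rw [Fintype.card_fin] at hcc
  refine ⟨fun i j k hij hjk h1 h2 => ?_, ?_, fun T hT => ?_⟩
  · have m1 := hX.mem_iff_notMem hij h1
    have m2 := hX.mem_iff_notMem hjk h2
    have m3 := hX.mem_iff_notMem (hij.trans hjk) (h1.trans h2)
    tauto
  · rcases hc with hc | hc
    · exact ⟨Xᶜ, by omega, hX.2⟩
    · exact ⟨X, hc, hX.1⟩
  · by_contra! hlt
    have c1 := Finset.card_inter_add_card_sdiff T X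
    have c2 : (T ∩ X).card ≤ X.card := Finset.card_le_card Finset.inter_subset_right
    have c3 : (T \ X).card ≤ Xᶜ.card := Finset.card_le_card fun x hx => by
      simpa using (Finset.mem_sdiff.1 hx).2
    have c4 : (T ∩ X).card * (T \ X).card ≤ crossInv π X := by
      rw [← Finset.card_product]
      apply Finset.card_le_card
      rintro ⟨c, d⟩ hcd
      simp only [Finset.mem_product, Finset.mem_inter, Finset.mem_sdiff, Finset.mem_filter,
        Finset.mem_compl] at hcd ⊢
      obtain ⟨⟨hcT, hcX⟩, hdT, hdX⟩ := hcd
      refine ⟨⟨hcX, hdX⟩, ?_⟩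
      rcases lt_trichotomy c d with hlt | rfl | hlt
      · exact Or.inl ⟨hlt, hT hcT hdT hlt⟩
      · exact absurd hcX hdX
      · exact Or.inr ⟨hlt, hT hdT hcT hlt⟩
    have p1 : 1 ≤ (T ∩ X).card := by omega
    have p2 : 1 ≤ (T \ X).card := by omega
    -- A product of two positive integers is at least their sum minus one, here at least s ≥ r,
    -- against fewer than r cross inversions.
    nlinarith

theorem choose_two_add (s r : ℕ) :
    (s + r).choose 2 = s.choose 2 + r.choose 2 + s * r := by
  rw [Nat.add_choose_eq]
  simp [Finset.Nat.antidiagonal_succ]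
  ring

theorem IsTwoColumn.le_invCount {s r : ℕ} (hn : n = s + r) {π : Equiv.Perm (Fin n)}
    (h : IsTwoColumn s π) : s.choose 2 + r.choose 2 ≤ invCount π := by
  have h1 := (h.nonInvCount_bound hn).1
  have h2 := invCount_add_nonInvCount π
  have h2' := choose_two_add s r
  rw [← hn] at h2'
  omega

/-- The data `(X, π(X))` attached to a permutation of small excess. -/
theorem IsTwoColumn.exists_subset {s r Δ : ℕ} (hn : n = s + r) (hrs : r ≤ s) (hΔ : Δ < r)
    {π : Equiv.Perm (Fin n)} (h : IsTwoColumn s π)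
    (hinv : invCount π = s.choose 2 + r.choose 2 + Δ) :
    ∃ X : Finset (Fin n), (X.card = r ∨ X.card = s) ∧ AntiOnBoth π X ∧
      subsetInv X + subsetInv (X.map π.toEmbedding) = Δ := by
  have h2 := invCount_add_nonInvCount π
  have h2' := choose_two_add s r
  rw [← hn] at h2'
  obtain ⟨X, hXr, hX⟩ := (h.nonInvCount_bound hn).2 (by omega)
  have hXc : Xᶜ.card = s := by
    rw [Finset.card_compl, Fintype.card_fin]
    omega
  have h3 := hX.nonInvCount_add
  rw [hXr, hXc, mul_comm] at h3
  have h4 : crossInv π X = Δ := by omega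
  rcases hX.separated_or (by omega) with hs | hs
  · exact ⟨X, Or.inl hXr, hX, by rw [← hs.crossInv_eq, h4]⟩
  · exact ⟨Xᶜ, Or.inr hXc, hX.compl, by rw [← hs.crossInv_eq, crossInv_compl, h4]⟩

theorem AntiOnBoth.of_subset {s r Δ : ℕ} (hn : n = s + r) (hrs : r ≤ s) (hΔ : Δ < r)
    {π : Equiv.Perm (Fin n)} {X : Finset (Fin n)} (hX : AntiOnBoth π X)
    (hc : X.card = r ∨ X.card = s)
    (h : subsetInv X + subsetInv (X.map π.toEmbedding) = Δ) :
    IsTwoColumn s π ∧ invCount π = s.choose 2 + r.choose 2 + Δ ∧ X = ascentStarts π := by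
  have hcc := Finset.card_compl X
  rw [Fintype.card_fin] at hcc
  have hs : Separated π X := Separated.of_subsetInv_le hX.1 (by omega)
  have h4 : crossInv π X = Δ := by rw [hs.crossInv_eq, h]
  refine ⟨hX.isTwoColumn hn hrs hc (by omega), ?_, hs.eq_ascentStarts hX (by omega)⟩
  have h2 := invCount_add_nonInvCount π
  have h2' := choose_two_add s r
  rw [← hn] at h2'
  have h3 := hX.nonInvCount_add
  have h5 : X.card * Xᶜ.card = s * r := by
    rcases hc with hc | hc
    · rw [hc, show Xᶜ.card = s by omega, mul_comm]
    · rw [hc, show Xᶜ.card = r by omega]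
  omega

/-- The bijection sends π to `ascentStarts π` and its image. The separated set may have size r or s,
so both families of pairs occur. -/
theorem ncard_isTwoColumn_excess {s r Δ : ℕ} (hn : n = s + r) (hrs : r ≤ s) (hΔ : Δ < r) :
    {π : Equiv.Perm (Fin n) | IsTwoColumn s π ∧
      invCount π = s.choose 2 + r.choose 2 + Δ}.ncard =
        coloredPartitionCount 2 Δ * (if s = r then 1 else 2) := by
  have hcard : (subsetPairs n r Δ ∪ subsetPairs n s Δ).card =
      coloredPartitionCount 2 Δ * (if s = r then 1 else 2) := by
    have c1 := card_subsetPairs (n := n) (a := r) (b := s) (k := Δ) (by omega) (by omega) (by omega)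
    have c2 := card_subsetPairs (n := n) (a := s) (b := r) (k := Δ) (by omega) (by omega) (by omega)
    split_ifs with hsr
    · rw [hsr, Finset.union_self, c1, mul_one]
    · rw [Finset.card_union_of_disjoint, c1, c2, mul_two]
      rw [Finset.disjoint_left]
      intro p hp hq
      simp only [subsetPairs, Finset.mem_filter] at hp hq
      omega
  rw [← hcard, ← Set.ncard_coe_finset]
  have hcanon : ∀ π : Equiv.Perm (Fin n), IsTwoColumn s π →
      invCount π = s.choose 2 + r.choose 2 + Δ →
        ((ascentStarts π).card = r ∨ (ascentStarts π).card = s) ∧ AntiOnBoth π (ascentStarts π) ∧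
          subsetInv (ascentStarts π) + subsetInv ((ascentStarts π).map π.toEmbedding) = Δ := by
    intro π h1 h2
    obtain ⟨X, hc, hX, h3⟩ := h1.exists_subset hn hrs hΔ h2
    obtain ⟨-, -, rfl⟩ := hX.of_subset hn hrs hΔ hc h3
    exact ⟨hc, hX, h3⟩
  refine Set.ncard_congr (fun π _ => (ascentStarts π, (ascentStarts π).map π.toEmbedding)) ?_ ?_ ?_
  · rintro π ⟨h1, h2⟩
    obtain ⟨hc, -, h3⟩ := hcanon π h1 h2
    simp only [subsetPairs, Finset.coe_union, Finset.coe_filter, Set.mem_union, Set.mem_ofPred_eq,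
      Finset.mem_univ, true_and, Finset.card_map]
    tauto
  · rintro π σ ⟨h1, h2⟩ ⟨h3, h4⟩ heq
    rw [Prod.ext_iff] at heq
    obtain ⟨-, hX, -⟩ := hcanon π h1 h2
    obtain ⟨-, hY, -⟩ := hcanon σ h3 h4
    simp only at heq
    rw [← heq.1] at hY
    refine hX.eq_of_map_eq hY (heq.2.trans ?_)
    rw [heq.1]
  · rintro ⟨X, Y⟩ hXY
    simp only [subsetPairs, Finset.coe_union, Finset.coe_filter, Set.mem_union, Set.mem_ofPred_eq,
      Finset.mem_univ, true_and] at hXY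
    obtain ⟨π, hX, rfl⟩ := exists_antiOnBoth (X := X) (Y := Y) (by omega)
    obtain ⟨h1, h2, h3⟩ := hX.of_subset hn hrs hΔ (by omega) (by omega)
    exact ⟨π, ⟨h1, h2⟩, by rw [← h3]⟩

end TwoColumns

/-! ### Young diagrams with two columns and the conclusion -/

theorem YoungDiagram.rowLens_of_transpose_rowLens {s r : ℕ} {lam : YoungDiagram}
    (h : lam.transpose.rowLens = [s, r]) :
    r ≤ s ∧ lam.card = s + r ∧
      lam.rowLens = List.replicate r 2 ++ List.replicate (s - r) 1 := by
  have h2 : lam.rowLen 0 = 2 := by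
    have := congrArg List.length h
    simpa using this
  have hs : lam.colLen 0 = s := by
    have := congrArg (·[0]?) h
    simpa [YoungDiagram.rowLens, h2] using this
  have hr : lam.colLen 1 = r := by
    have := congrArg (·[1]?) h
    simpa [YoungDiagram.rowLens, h2] using this
  have hrs : r ≤ s := by
    rw [← hs, ← hr]
    exact lam.colLen_anti 0 1 (by omega)
  refine ⟨hrs, ?_, ?_⟩
  · have : lam.cells = Finset.range s ×ˢ {0} ∪ Finset.range r ×ˢ {1} := by
      ext ⟨i, j⟩
      simp only [YoungDiagram.mem_cells, Finset.mem_union, Finset.mem_product, Finset.mem_range,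
        Finset.mem_singleton]
      constructor
      · intro hm
        have hj : j < 2 := by
          have := YoungDiagram.mem_iff_lt_rowLen.1 (lam.up_left_mem (Nat.zero_le i) le_rfl hm)
          omega
        have hi := YoungDiagram.mem_iff_lt_colLen.1 hm
        interval_cases j <;> omega
      · rintro (⟨h1, rfl⟩ | ⟨h1, rfl⟩) <;> rw [YoungDiagram.mem_iff_lt_colLen] <;> omega
    rw [YoungDiagram.card, this, Finset.card_union_of_disjoint]
    · simp
    · rw [Finset.disjoint_left]
      rintro ⟨i, j⟩ h1 h2
      simp at h1 h2
      omega
  · apply List.ext_getElem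
    · simp [hs]
      omega
    · intro i h1 h3
      have hi : i < s := by simpa [hs] using h1
      have e0 : 0 < lam.rowLen i := by
        rw [← YoungDiagram.mem_iff_lt_rowLen, YoungDiagram.mem_iff_lt_colLen]
        omega
      have e1 : 1 < lam.rowLen i ↔ i < r := by
        rw [← YoungDiagram.mem_iff_lt_rowLen, YoungDiagram.mem_iff_lt_colLen, hr]
      have e2 := lam.rowLen_anti 0 i (by omega)
      rw [List.getElem_append]
      simp only [YoungDiagram.rowLens, List.getElem_map, List.getElem_range, List.length_replicate,
        List.getElem_replicate]
      split_ifs <;> omega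

theorem theorem2 (n s r Δ : ℕ) (lam : YoungDiagram) (hn : lam.card = n)
    (hlam : lam.transpose.rowLens = [s, r]) (hΔ : Δ < r) :
    IsLeast (invCount '' permsOfShape n lam) (s.choose 2 + r.choose 2) ∧
      (permsOfShapeExcess n lam Δ).ncard =
        coloredPartitionCount 2 Δ * (if s = r then 1 else 2) := by
  obtain ⟨hrs, hcard, hrows⟩ := YoungDiagram.rowLens_of_transpose_rowLens hlam
  have hsr : n = s + r := by omega
  have hmem : ∀ π : Equiv.Perm (Fin n), π ∈ permsOfShape n lam ↔ IsTwoColumn s π := fun π => by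
    rw [permsOfShape, Set.mem_ofPred_eq, hrows]
    exact rsShape_eq_iff hsr (by omega) hrs π
  have hleast : IsLeast (invCount '' permsOfShape n lam) (s.choose 2 + r.choose 2) := by
    constructor
    -- The empty partition gives an r-set X without inversions; the permutation attached to the pair
    -- (X, X) attains the minimum.
    · obtain ⟨X, hX, hX'⟩ := exists_gapMultiset_eq (n := n) (a := r) (b := s) (M := 0) (by omega)
        (by simp) (by simp) (by simp)
      have h0 : subsetInv X = 0 := by rw [← sum_gapMultiset, hX', Multiset.sum_zero]
      obtain ⟨π, hπ, hπX⟩ := exists_antiOnBoth (X := X) (Y := X) rfl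
      obtain ⟨h1, h2, -⟩ := hπ.of_subset (Δ := 0) hsr hrs (by omega) (Or.inl hX)
        (by rw [hπX, h0])
      exact ⟨π, (hmem π).2 h1, h2⟩
    · rintro _ ⟨π, hπ, rfl⟩
      exact ((hmem π).1 hπ).le_invCount hsr
  refine ⟨hleast, ?_⟩
  rw [← ncard_isTwoColumn_excess hsr hrs hΔ]
  congr 1
  ext π
  simp only [permsOfShapeExcess, minInvCount, hleast.csInf_eq, hmem, Set.mem_ofPred_eq]
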